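/- For a perfect matching $M$ of a finite graph $G$, an anti-forcing set of $M$ is a set $S\subseteq E(G)\setminus M$ such that $M$ is the only perfect matching of $G-S$; the anti-forcing number $af(G,M)$ is the minimum size of an anti-forcing set of $M$; and the anti-forcing polynomial of $G$ is $Af(G,x)=\sum_{M}x^{af(G,M)}$, the sum being over all perfect matchings $M$ of $G$. For $n\ge 1$ let $G_n$ be the polyomino graph with vertices $u_i,v_i$ $(0\le i\le 2n)$ and $w_i,z_i$ $(1\le i\le 2n)$, and with edges $u_iu_{i+1},\ v_iv_{i+1}$ $(0\le i<2n)$; $u_iv_i$ $(0\le i\le 2n)$; $w_iu_i,\ v_iz_i$ $(1\le i\le 2n)$; $w_{2k-1}w_{2k},\ z_{2k-1}z_{2k}$ $(1\le k\le n)$. (It consists of $4n$ squares.) **Theorem.** For every integer $n\ge 1$, $$Af(G_n,x)=R_n(x)+Q_n(x)+3x^{n+1}+x^n,$$ where, with $$\alpha=n-2i+j,\quad \beta=3i-2j-n,\quad \gamma=k+m+r,\quad \theta=q+3j+2s+l-k-r-m-3i,$$ the polynomials $R_n$ and $Q_n$ are the following eight-fold sums (over integers; a sum whose lower limit exceeds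 its upper limit is empty): $$\begin{aligned} R_n(x)=x^n&\sum_{q=2}^{2n}\ \sum_{i=\max\{n-q,\lceil n/3\rceil\}}^{n}\ \sum_{j=\max\{0,2i-n\}}^{\min\{q+3i-2n,\lfloor\frac{4i-q}{2}\rfloor,\lfloor\frac{3i-n}{2}\rfloor\}}\ \sum_{k=\max\{0,\lceil\frac{q+4j-4i}{2}\rceil\}}^{\min\{j,q+3i-j-2n\}}\ \sum_{r=\max\{0,q+4j-k-4i\}}^{\min\{k,q+3i-k-j-2n\}}\\ &\sum_{m=\max\{0,q+5j+n-k-r-6i\}}^{\min\{\alpha,q+3i-k-r-j-2n\}}\ \sum_{s=\max\{0,\gamma+n-j-q\}}^{\min\{\beta,\lfloor\frac{\gamma+6i-5j-n-q}{3}\rfloor\}}\ \sum_{l=\max\{0,\gamma+3i-3j-2s-q\}}^{\min\{\beta-s,\lfloor\frac{\gamma+6i-5j-3s-n-q}{2}\rfloor\}}\\ &\binom ij\binom{i-j}{\alpha}\binom jk\binom kr\binom{\alpha}{m}\binom{\beta}{s}\binom{\beta-s}{l}\binom{\beta-s-l}{\theta}(-1)^{\beta+l}\,2^{\beta-s-l}\,3^{k+i-j-m-l-\theta}\,x^q,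 \end{aligned}$$ $$\begin{aligned} Q_n(x)=x^n&\sum_{q=2}^{2n}\ \sum_{i=\max\{n-q+1,\lceil\frac{n-1}{3}\rceil\}}^{n-1}\ \sum_{j=\max\{0,2i-n+1\}}^{\min\{q+3i-2n,\lfloor\frac{4i-q+2}{2}\rfloor,\lfloor\frac{3i-n+1}{2}\rfloor\}}\ \sum_{k=\max\{0,\lceil\frac{q+4j-4i-2}{2}\rceil\}}^{\min\{j,q+3i-j-2n\}}\ \sum_{r=\max\{0,q+4j-k-4i-2\}}^{\min\{k,q+3i-k-j-2n\}}\\ &\sum_{m=\max\{0,q+5j+n-k-r-6i-3\}}^{\min\{\alpha-1,q+3i-k-r-j-2n\}}\ \sum_{s=\max\{0,\gamma+n-j-q+1\}}^{\min\{\beta+1,\lfloor\frac{\gamma+6i-5j-n-q+3}{3}\rfloor\}}\ \sum_{l=\max\{0,\gamma+3i-3j-2s-q+2\}}^{\min\{\beta-s+1,\lfloor\frac{\gamma+6i-5j-3s-n-q+3}{2}\rfloor\}}\\ &\binom ij\binom{i-j}{\alpha-1}\binom jk\binom kr\binom{\alpha-1}{m}\binom{\beta+1}{s}\binom{\beta-s+1}{l}\binom{\beta-s-l+1}{\theta-2}(-1)^{\beta+l+2}\,2^{\beta-s-l+1}\,3^{k+i-j-m-l-\theta+2}\,x^q.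 \end{aligned}$$ -/

import Mathlib

namespace PolyominoAF

/-! ### Anti-forcing sets, anti-forcing numbers, anti-forcing polynomial -/

section AntiForcing

variable {V : Type*}

/-- `S` is an anti-forcing set of the perfect matching `M` of `G`: it consists of edges of `G`
outside `M`, and `G - S` has a single perfect matching, namely `M`. -/
def IsAntiForcingSet (G : SimpleGraph V) (M : G.Subgraph) (S : Set (Sym2 V)) : Prop :=
  S ⊆ G.edgeSet \ M.edgeSet ∧
    ∃ N : (G.deleteEdges S).Subgraph, N.edgeSet = M.edgeSet ∧
      ∀ N' : (G.deleteEdges S).Subgraph, N'.IsPerfectMatching ↔ N' = N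

/-- The anti-forcing number `af(G, M)`: the size of a minimum anti-forcing set of `M`. -/
noncomputable def antiForcingNumber (G : SimpleGraph V) (M : G.Subgraph) : ℕ :=
  sInf {k : ℕ | ∃ S : Finset (Sym2 V), IsAntiForcingSet G M (S : Set (Sym2 V)) ∧ S.card = k}

open Classical in
/-- The anti-forcing polynomial `Af(G, x) = ∑_M x ^ af(G, M)`, the sum being over all perfect
matchings `M` of the finite graph `G`. -/
noncomputable def antiForcingPolynomial [Fintype V] (G : SimpleGraph V) : Polynomial ℤ :=
  ∑ M : {M : G.Subgraph // M.IsPerfectMatching}, Polynomial.X ^ antiForcingNumber G M.1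

end AntiForcing

/-! ### The polyomino graph `G_n` -/

/-- The vertices `u_0, …, u_{2n}`, `v_0, …, v_{2n}`, `w_1, …, w_{2n}`, `z_1, …, z_{2n}` of `G_n`.
`u i` is `u_i` and `v i` is `v_i`, whereas `w a` is `w_{a+1}` and `z a` is `z_{a+1}`. -/
inductive Vertex (n : ℕ) : Type
  | u (i : Fin (2 * n + 1)) : Vertex n
  | v (i : Fin (2 * n + 1)) : Vertex n
  | w (a : Fin (2 * n)) : Vertex n
  | z (a : Fin (2 * n)) : Vertex n
  deriving DecidableEq, Fintype

/-- The edges of `G_n`, each in one orientation. -/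
def edgeRel (n : ℕ) : Vertex n → Vertex n → Prop
  -- `u_i u_{i+1}` and `v_i v_{i+1}` for `0 ≤ i < 2n`
  | .u i, .u j => i.val + 1 = j.val
  | .v i, .v j => i.val + 1 = j.val
  -- `u_i v_i` for `0 ≤ i ≤ 2n`
  | .u i, .v j => i = j
  -- `w_i u_i` and `v_i z_i` for `1 ≤ i ≤ 2n`
  | .w a, .u j => a.val + 1 = j.val
  | .v i, .z b => i.val = b.val + 1
  -- `w_{2k-1} w_{2k}` and `z_{2k-1} z_{2k}` for `1 ≤ k ≤ n`
  | .w a, .w b => Even a.val ∧ a.val + 1 = b.val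
  | .z a, .z b => Even a.val ∧ a.val + 1 = b.val
  | _, _ => False

/-- The polyomino graph `G_n` for `n ≥ 1`, consisting of the `4n` squares
`u_{2k-2} u_{2k-1} v_{2k-1} v_{2k-2}`, `w_{2k-1} w_{2k} u_{2k} u_{2k-1}`,
`u_{2k-1} u_{2k} v_{2k} v_{2k-1}` and `v_{2k-1} v_{2k} z_{2k} z_{2k-1}`, `k = 1, …, n`. -/
def polyomino (n : ℕ) : SimpleGraph (Vertex n) := SimpleGraph.fromRel (edgeRel n)

/-! ### The explicit sums `R_n` and `Q_n`

All summation indices are integers. A sum from `a` to `b` is empty if `a > b`. In every term within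
the summation ranges, the entries of the binomial coefficients and the exponents are nonnegative,
so that their conversion to natural numbers is harmless. -/

/-- The binomial coefficient of two nonnegative integers. -/
def binom (a b : ℤ) : ℤ := (a.toNat.choose b.toNat : ℤ)

/-- `⌊a / b⌋` for `b > 0`. -/
def floorQ (a b : ℤ) : ℤ := a / b

/-- `⌈a / b⌉` for `b > 0`. -/
def ceilQ (a b : ℤ) : ℤ := -(-a / b)

def alpha (n i j : ℤ) : ℤ := n - 2 * i + j

def beta (n i j : ℤ) : ℤ := 3 * i - 2 * j - n

def gamma (k r m : ℤ) : ℤ := k + m + r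

def theta (q i j k r m s l : ℤ) : ℤ := q + 3 * j + 2 * s + l - k - r - m - 3 * i

/-- The summand of `R_n` without the power of `x`. -/
def termR (n q i j k r m s l : ℤ) : ℤ :=
  binom i j * binom (i - j) (alpha n i j) * binom j k * binom k r * binom (alpha n i j) m *
    binom (beta n i j) s * binom (beta n i j - s) l *
    binom (beta n i j - s - l) (theta q i j k r m s l) *
    (-1) ^ (beta n i j + l).toNat * 2 ^ (beta n i j - s - l).toNat *
    3 ^ (k + i - j - m - l - theta q i j k r m s l).toNat

/-- The coefficient of `x ^ (n + q)` in `R_n`, a seven-fold sum. -/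
noncomputable def coeffR (n q : ℤ) : ℤ :=
  ∑ i ∈ Finset.Icc (max (n - q) (ceilQ n 3)) n,
  ∑ j ∈ Finset.Icc (max 0 (2 * i - n))
      (min (q + 3 * i - 2 * n) (min (floorQ (4 * i - q) 2) (floorQ (3 * i - n) 2))),
  ∑ k ∈ Finset.Icc (max 0 (ceilQ (q + 4 * j - 4 * i) 2)) (min j (q + 3 * i - j - 2 * n)),
  ∑ r ∈ Finset.Icc (max 0 (q + 4 * j - k - 4 * i)) (min k (q + 3 * i - k - j - 2 * n)),
  ∑ m ∈ Finset.Icc (max 0 (q + 5 * j + n - k - r - 6 * i))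
      (min (alpha n i j) (q + 3 * i - k - r - j - 2 * n)),
  ∑ s ∈ Finset.Icc (max 0 (gamma k r m + n - j - q))
      (min (beta n i j) (floorQ (gamma k r m + 6 * i - 5 * j - n - q) 3)),
  ∑ l ∈ Finset.Icc (max 0 (gamma k r m + 3 * i - 3 * j - 2 * s - q))
      (min (beta n i j - s) (floorQ (gamma k r m + 6 * i - 5 * j - 3 * s - n - q) 2)),
    termR n q i j k r m s l

/-- `R_n(x)`. -/
noncomputable def R (n : ℕ) : Polynomial ℤ :=
  Polynomial.X ^ n *
    ∑ q ∈ Finset.Icc 2 (2 * n), Polynomial.C (coeffR (n : ℤ) (q : ℤ)) * Polynomial.X ^ q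

/-- The summand of `Q_n` without the power of `x`. -/
def termQ (n q i j k r m s l : ℤ) : ℤ :=
  binom i j * binom (i - j) (alpha n i j - 1) * binom j k * binom k r * binom (alpha n i j - 1) m *
    binom (beta n i j + 1) s * binom (beta n i j - s + 1) l *
    binom (beta n i j - s - l + 1) (theta q i j k r m s l - 2) *
    (-1) ^ (beta n i j + l + 2).toNat * 2 ^ (beta n i j - s - l + 1).toNat *
    3 ^ (k + i - j - m - l - theta q i j k r m s l + 2).toNat

/-- The coefficient of `x ^ (n + q)` in `Q_n`, a seven-fold sum. -/
noncomputable def coeffQ (n q : ℤ) : ℤ :=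
  ∑ i ∈ Finset.Icc (max (n - q + 1) (ceilQ (n - 1) 3)) (n - 1),
  ∑ j ∈ Finset.Icc (max 0 (2 * i - n + 1))
      (min (q + 3 * i - 2 * n) (min (floorQ (4 * i - q + 2) 2) (floorQ (3 * i - n + 1) 2))),
  ∑ k ∈ Finset.Icc (max 0 (ceilQ (q + 4 * j - 4 * i - 2) 2)) (min j (q + 3 * i - j - 2 * n)),
  ∑ r ∈ Finset.Icc (max 0 (q + 4 * j - k - 4 * i - 2)) (min k (q + 3 * i - k - j - 2 * n)),
  ∑ m ∈ Finset.Icc (max 0 (q + 5 * j + n - k - r - 6 * i - 3))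
      (min (alpha n i j - 1) (q + 3 * i - k - r - j - 2 * n)),
  ∑ s ∈ Finset.Icc (max 0 (gamma k r m + n - j - q + 1))
      (min (beta n i j + 1) (floorQ (gamma k r m + 6 * i - 5 * j - n - q + 3) 3)),
  ∑ l ∈ Finset.Icc (max 0 (gamma k r m + 3 * i - 3 * j - 2 * s - q + 2))
      (min (beta n i j - s + 1) (floorQ (gamma k r m + 6 * i - 5 * j - 3 * s - n - q + 3) 2)),
    termQ n q i j k r m s l

/-- `Q_n(x)`. -/
noncomputable def Q (n : ℕ) : Polynomial ℤ :=
  Polynomial.X ^ n *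
    ∑ q ∈ Finset.Icc 2 (2 * n), Polynomial.C (coeffQ (n : ℤ) (q : ℤ)) * Polynomial.X ^ q

end PolyominoAF

/-! ### The explicit coefficients as sums with natural ranges -/

namespace PolyominoAF

open Finset

/-! Cut the graph at its even columns into `n` equal parts. In a perfect matching the two edges
leaving an even column to the right are used together or not at all, and a part meets the matching
in one of eight patterns. Perfect matchings thus correspond to words in eight letters whose
consecutive letters fit (`coversOnce_edges`, `exists_edges_eq`).

A set of edges outside `M` is anti-forcing exactly when it meets every other perfect matching
(`isAntiForcingSet_iff`). An automaton with three states reads the word and adds up local costs, and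
the total is the anti-forcing number (`antiForcingNumber_eq_cost`). For the upper bound each step
contributes a local cut, and only deviations allowed by the state survive it (`cut_step`,
`eq_of_avoids_cut`). For the lower bound a potential depending on the state is carried from left to
right; that it survives each step is a finite family of linear integer problems (`cost_step`,
`cost_le_of_meets`).

The polynomial is therefore a sum of entries of a power of a 3 × 3 transfer matrix applied to an
initial vector. With `1 - A t - B t ^ 2 - C t ^ 3` the reciprocal characteristic polynomial and `W
n` the coefficients of its inverse, it equals `W n - X ^ 3 * W (n - 1)` for `n ≥ 1` (`genPoly_eq`).
Expanding the geometric series multinomially identifies the sum in `R` with the coefficients of `W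
n` (`coeffR_eq_coeff_W`), and `coeffQ` is `-coeffR` at `n - 1`, `q - 2` (`coeffQ_eq`). The sums
start at `q = 2`; the coefficients for `q = 0, 1` are the two separate terms (`R_add_Q_eq`). -/

theorem sum_Icc_eq_sum_range {lo hi : ℤ} {N : ℕ} {f : ℤ → ℤ} {g : ℕ → ℤ} (h0 : 0 ≤ lo)
    (hN : lo ≤ hi → hi < N) (h1 : ∀ x : ℕ, lo ≤ x → x ≤ hi → f x = g x)
    (h2 : ∀ x : ℕ, x < N → ¬(lo ≤ x ∧ x ≤ hi) → g x = 0) :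
    ∑ x ∈ Icc lo hi, f x = ∑ x ∈ range N, g x := by
  rw [← Finset.sum_filter_of_ne (s := range N) (p := fun x : ℕ => lo ≤ x ∧ (x : ℤ) ≤ hi)]
  · symm
    refine Finset.sum_bij (fun x _ => (x : ℤ)) ?_ ?_ ?_ ?_
    · intro x hx
      simp only [mem_filter] at hx
      simp [hx.2]
    · intro x _ y _ h
      exact_mod_cast h
    · intro y hy
      simp only [mem_Icc] at hy
      refine ⟨y.toNat, ?_, ?_⟩
      · simp only [mem_filter, mem_range]
        have := hN (hy.1.trans hy.2)
        omega
      · exact Int.toNat_of_nonneg (h0.trans hy.1)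
    · intro x hx
      simp only [mem_filter] at hx
      exact (h1 x hx.2.1 hx.2.2).symm
  · intro x hx hne
    by_contra h
    exact hne (h2 x (mem_range.1 hx) h)

/-- The summand of the coefficient formula, in terms of natural numbers. -/
def natTerm (q i j a b k r m s l : ℕ) : ℤ :=
  if k + r + 3 * a + m + s + 2 * l + 3 * (b - s - l) ≤ q then
    (i.choose j * (i - j).choose a * j.choose k * k.choose r * a.choose m * b.choose s *
      (b - s).choose l *
      (b - s - l).choose (q - (k + r + 3 * a + m + s + 2 * l + 3 * (b - s - l))) : ℤ) *
      (-1) ^ (b + l) * 2 ^ (b - s - l) *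
      3 ^ (k + (a - m) + s +
        (b - s - l - (q - (k + r + 3 * a + m + s + 2 * l + 3 * (b - s - l)))))
  else 0

theorem natTerm_eq_zero {q i j a b k r m s l : ℕ}
    (h : ¬ (k + r + 3 * a + m + s + 2 * l + 3 * (b - s - l) ≤ q ∧
      q ≤ k + r + 3 * a + m + s + 2 * l + 4 * (b - s - l))) :
    natTerm q i j a b k r m s l = 0 := by
  unfold natTerm
  split_ifs with h1
  · rw [Nat.choose_eq_zero_of_lt (n := b - s - l) (by omega)]
    simp
  · rfl

theorem termR_eq_natTerm {n q i j a b k r m s l : ℕ} (hj : j ≤ i) (ha : 2 * i + a = n + j)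
    (hb : 3 * i = n + 2 * j + b) (hm : m ≤ a) (hs : s + l ≤ b)
    (h : k + r + 3 * a + m + s + 2 * l + 3 * (b - s - l) ≤ q ∧
      q ≤ k + r + 3 * a + m + s + 2 * l + 4 * (b - s - l)) :
    termR n q i j k r m s l = natTerm q i j a b k r m s l := by
  have e1 : alpha n i j = (a : ℤ) := by unfold alpha; omega
  have e2 : beta n i j = (b : ℤ) := by unfold beta; omega
  have e3 : theta q i j k r m s l =
      ((q - (k + r + 3 * a + m + s + 2 * l + 3 * (b - s - l)) : ℕ) : ℤ) := by
    unfold theta; omega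
  unfold termR natTerm
  rw [if_pos h.1, e1, e2, e3]
  set t := q - (k + r + 3 * a + m + s + 2 * l + 3 * (b - s - l)) with ht
  have e4 : (i - j : ℤ) = ((i - j : ℕ) : ℤ) := by omega
  have e5 : (b - s : ℤ) = ((b - s : ℕ) : ℤ) := by omega
  have e6 : (b - s - l : ℤ) = ((b - s - l : ℕ) : ℤ) := by omega
  -- This uses `i - j = a + b`.
  have e7 : ((k + i - j - m - l - t : ℤ)).toNat = k + (a - m) + s + (b - s - l - t) := by omega
  have e8 : ((b + l : ℤ)).toNat = b + l := by omega
  rw [e7, e8, e6, e5, e4]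
  simp only [binom, Int.toNat_natCast]

/-- The sum of `natTerm` over all indices but `i` and `j`. -/
def natSum (q i j a b : ℕ) : ℤ :=
  ∑ k ∈ range (j + 1), ∑ r ∈ range (k + 1), ∑ m ∈ range (a + 1), ∑ s ∈ range (b + 1),
    ∑ l ∈ range (b - s + 1), natTerm q i j a b k r m s l

theorem ceilQ_le {a b x : ℤ} (hb : 0 < b) : ceilQ a b ≤ x ↔ a ≤ x * b := by
  unfold ceilQ
  rw [neg_le, Int.le_ediv_iff_mul_le hb, neg_mul, neg_le_neg_iff]

theorem le_floorQ {a b x : ℤ} (hb : 0 < b) : x ≤ floorQ a b ↔ x * b ≤ a :=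
  Int.le_ediv_iff_mul_le hb

/-- The linear constraints under which `natTerm` may be nonzero. -/
structure Admissible (n q i j k r m s l : ℤ) : Prop where
  r_nonneg : 0 ≤ r
  m_nonneg : 0 ≤ m
  s_nonneg : 0 ≤ s
  l_nonneg : 0 ≤ l
  j_nonneg : 0 ≤ j
  r_le : r ≤ k
  k_le : k ≤ j
  m_le : m ≤ n - 2 * i + j
  theta_nonneg : k + r + m + 3 * i ≤ q + 3 * j + 2 * s + l
  theta_le : q + n + 5 * j + 3 * s + 2 * l ≤ 6 * i + k + r + m
  sl_le : s + l ≤ 3 * i - 2 * j - n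

theorem natTerm_eq_zero_of_not {n q i j a b k r m s l : ℕ} {p : Prop}
    (ha : 2 * i + a = n + j) (hb : 3 * i = n + 2 * j + b) (hk : k ∈ range (j + 1))
    (hr : r ∈ range (k + 1)) (hm : m ∈ range (a + 1)) (hs : s ∈ range (b + 1))
    (hl : l ∈ range (b - s + 1)) (hp : ¬ p) (h : Admissible n q i j k r m s l → p) :
    natTerm q i j a b k r m s l = 0 := by
  simp only [mem_range] at hk hr hm hs hl
  refine natTerm_eq_zero fun h' => hp (h ?_)
  obtain ⟨c, hc⟩ : ∃ c, b = s + l + c := ⟨b - s - l, by omega⟩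
  have e : b - s - l = c := by omega
  rw [e] at h'
  constructor <;> omega

/-- The printed limits are linear consequences of `Admissible`, obtained by eliminating the inner
indices. A term outside some limit is therefore zero, and the limits can be relaxed one sum at a
time to the ranges natural for the binomials. No limit has to be sharp, but the innermost limits
must keep `theta` between `0` and `b - s - l`, where the integer term agrees with `natTerm`. -/
theorem coeffR_eq (n q : ℕ) : coeffR n q = ∑ i ∈ range (n + 1), ∑ j ∈ range (i + 1),
    if 2 * i ≤ n + j ∧ n + 2 * j ≤ 3 * i then natSum q i j (n + j - 2 * i) (3 * i - (n + 2 * j))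
    else 0 := by
  have h2 : (0 : ℤ) < 2 := by norm_num
  have h3 : (0 : ℤ) < 3 := by norm_num
  unfold coeffR
  refine sum_Icc_eq_sum_range (le_max_of_le_right ?_) (by omega) (fun i hi1 hi2 => ?_)
    (fun i hi hi' => ?_)
  · unfold ceilQ
    omega
  swap
  · refine sum_eq_zero fun j hj => ?_
    split_ifs with hc
    · refine sum_eq_zero fun k hk => sum_eq_zero fun r hr => sum_eq_zero fun m hm =>
        sum_eq_zero fun s hs => sum_eq_zero fun l hl =>
        natTerm_eq_zero_of_not (n := n) (by omega) (by omega) hk hr hm hs hl hi' fun h => ?_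
      obtain ⟨⟩ := h
      rw [max_le_iff, ceilQ_le h3]
      refine ⟨⟨?_, ?_⟩, ?_⟩ <;> linarith
    · rfl
  rw [max_le_iff, ceilQ_le h3] at hi1
  obtain ⟨hi3, hi4⟩ := hi1
  refine sum_Icc_eq_sum_range (le_max_left _ _) (fun _ => ?_) (fun j hj1 hj2 => ?_)
    (fun j hj hj' => ?_)
  · refine (min_le_right _ _).trans_lt ((min_le_right _ _).trans_lt ?_)
    unfold floorQ
    omega
  swap
  · split_ifs with hc
    · refine sum_eq_zero fun k hk => sum_eq_zero fun r hr => sum_eq_zero fun m hm =>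
        sum_eq_zero fun s hs => sum_eq_zero fun l hl =>
        natTerm_eq_zero_of_not (n := n) (by omega) (by omega) hk hr hm hs hl hj' fun h => ?_
      obtain ⟨⟩ := h
      simp only [max_le_iff, le_min_iff, le_floorQ h2]
      refine ⟨⟨?_, ?_⟩, ?_, ?_, ?_⟩ <;> linarith
    · rfl
  simp only [max_le_iff, le_min_iff, le_floorQ h2] at hj1 hj2
  obtain ⟨hj3, hj4⟩ := hj1
  obtain ⟨hj5, hj6, hj7⟩ := hj2
  rw [if_pos (by omega)]
  obtain ⟨a, ha⟩ : ∃ a, a = n + j - 2 * i := ⟨_, rfl⟩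
  obtain ⟨b, hb⟩ : ∃ b, b = 3 * i - (n + 2 * j) := ⟨_, rfl⟩
  rw [← ha, ← hb]
  have ha2 : 2 * i + a = n + j := by omega
  have hb2 : 3 * i = n + 2 * j + b := by omega
  have ha' : alpha n i j = (a : ℤ) := by unfold alpha; omega
  have hb' : beta n i j = (b : ℤ) := by unfold beta; omega
  have hji : j ≤ i := by omega
  clear ha hb
  unfold natSum
  refine sum_Icc_eq_sum_range (le_max_left _ _) (fun _ => ?_) (fun k hk1 hk2 => ?_)
    (fun k hk hk' => ?_)
  · exact (min_le_left _ _).trans_lt (by push_cast; linarith)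
  swap
  · refine sum_eq_zero fun r hr => sum_eq_zero fun m hm =>
        sum_eq_zero fun s hs => sum_eq_zero fun l hl =>
        natTerm_eq_zero_of_not ha2 hb2 (mem_range.2 hk) hr hm hs hl hk' fun h => ?_
    obtain ⟨⟩ := h
    simp only [max_le_iff, le_min_iff, ceilQ_le h2]
    refine ⟨⟨?_, ?_⟩, ?_, ?_⟩ <;> linarith
  have hkj : k ≤ j := by exact_mod_cast (le_min_iff.1 hk2).1
  have hkm := mem_range.2 (Nat.lt_succ_of_le hkj)
  clear hk1 hk2
  refine sum_Icc_eq_sum_range (le_max_left _ _) (fun _ => ?_) (fun r hr1 hr2 => ?_)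
    (fun r hr hr' => ?_)
  · exact (min_le_left _ _).trans_lt (by push_cast; linarith)
  swap
  · refine sum_eq_zero fun m hm =>
        sum_eq_zero fun s hs => sum_eq_zero fun l hl =>
        natTerm_eq_zero_of_not ha2 hb2 hkm (mem_range.2 hr) hm hs hl hr' fun h => ?_
    obtain ⟨⟩ := h
    simp only [max_le_iff, le_min_iff]
    refine ⟨⟨?_, ?_⟩, ?_, ?_⟩ <;> linarith
  have hrk : r ≤ k := by exact_mod_cast (le_min_iff.1 hr2).1
  have hrm := mem_range.2 (Nat.lt_succ_of_le hrk)
  clear hr1 hr2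
  rw [ha']
  refine sum_Icc_eq_sum_range (le_max_left _ _) (fun _ => ?_) (fun m hm1 hm2 => ?_)
    (fun m hm hm' => ?_)
  · exact (min_le_left _ _).trans_lt (by push_cast; linarith)
  swap
  · refine sum_eq_zero fun s hs => sum_eq_zero fun l hl =>
        natTerm_eq_zero_of_not ha2 hb2 hkm hrm (mem_range.2 hm) hs hl hm' fun h => ?_
    obtain ⟨⟩ := h
    rw [max_le_iff, le_min_iff]
    have : (2 * i + a : ℤ) = n + j := by exact_mod_cast ha2
    refine ⟨⟨?_, ?_⟩, ?_, ?_⟩ <;> linarith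
  have hma : m ≤ a := by exact_mod_cast (le_min_iff.1 hm2).1
  have hmm := mem_range.2 (Nat.lt_succ_of_le hma)
  clear hm1 hm2
  rw [hb']
  have hb3 : (3 * i : ℤ) = n + 2 * j + b := by exact_mod_cast hb2
  refine sum_Icc_eq_sum_range (le_max_left _ _) (fun _ => ?_) (fun s hs1 hs2 => ?_)
    (fun s hs hs' => ?_)
  · exact (min_le_left _ _).trans_lt (by push_cast; linarith)
  swap
  · refine sum_eq_zero fun l hl =>
        natTerm_eq_zero_of_not ha2 hb2 hkm hrm hmm (mem_range.2 hs) hl hs' fun h => ?_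
    obtain ⟨⟩ := h
    simp only [max_le_iff, le_min_iff, le_floorQ h3, gamma]
    refine ⟨⟨?_, ?_⟩, ?_, ?_⟩ <;> linarith
  have hsb : s ≤ b := by exact_mod_cast (le_min_iff.1 hs2).1
  have hsm := mem_range.2 (Nat.lt_succ_of_le hsb)
  clear hs1 hs2
  refine sum_Icc_eq_sum_range (le_max_left _ _) (fun _ => ?_) (fun l hl1 hl2 => ?_)
    (fun l hl hl' => ?_)
  · exact (min_le_left _ _).trans_lt (by omega)
  swap
  · refine natTerm_eq_zero_of_not ha2 hb2 hkm hrm hmm hsm (mem_range.2 hl) hl' fun h => ?_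
    obtain ⟨⟩ := h
    simp only [max_le_iff, le_min_iff, le_floorQ h2, gamma]
    refine ⟨⟨?_, ?_⟩, ?_, ?_⟩ <;> linarith
  simp only [max_le_iff, le_min_iff, le_floorQ h2, gamma] at hl1 hl2
  obtain ⟨c, hc⟩ : ∃ c, b = s + l + c := ⟨b - s - l, by omega⟩
  have e : b - s - l = c := by omega
  refine termR_eq_natTerm hji ha2 hb2 hma (by omega) ?_
  rw [e]
  constructor <;> omega

/-- Passing from `n` to `n - 1` lowers `alpha` by one and raises `beta` by one, and `q - 2` lowers
`theta` by two. All limits and factors then match except for the sign. -/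
theorem coeffQ_eq (n q : ℤ) : coeffQ n q = -coeffR (n - 1) (q - 2) := by
  unfold coeffQ coeffR
  simp only [← sum_neg_distrib]
  have hg : ∀ i j, alpha (n - 1) i j = alpha n i j - 1 := by intros; unfold alpha; ring
  have hb : ∀ i j, beta (n - 1) i j = beta n i j + 1 := by intros; unfold beta; ring
  refine sum_congr (by congr 1; congr 1; ring) fun i _ => ?_
  refine sum_congr (by unfold floorQ; congr 2 <;> ring_nf) fun j _ => ?_
  refine sum_congr (by unfold ceilQ; congr 2 <;> ring_nf) fun k _ => ?_
  refine sum_congr (by congr 2 <;> ring_nf) fun r _ => ?_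
  refine sum_congr (by rw [hg]; congr 2 <;> ring_nf) fun m _ => ?_
  refine sum_congr (by rw [hb]; unfold floorQ; congr 2 <;> ring_nf) fun s hs => ?_
  refine sum_congr (by rw [hb]; unfold floorQ; congr 2 <;> ring_nf) fun l hl => ?_
  simp only [mem_Icc, hb] at hs hl
  have hl' := (le_min_iff.1 hl.2).1
  unfold termQ termR
  have ht : theta (q - 2) i j k r m s l = theta q i j k r m s l - 2 := by unfold theta; ring
  rw [hg, hb, ht]
  have e1 : beta n i j + 1 - s = beta n i j - s + 1 := by ring
  have e2 : beta n i j - s + 1 - l = beta n i j - s - l + 1 := by ring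
  have e3 : k + i - j - m - l - (theta q i j k r m s l - 2) =
    k + i - j - m - l - theta q i j k r m s l + 2 := by ring
  -- This odd shift of the exponent of `-1` is the source of the minus sign.
  have e4 : (beta n i j + l + 2).toNat = (beta n i j + 1 + l).toNat + 1 := by
    have := (le_max_left _ _).trans hs.1
    have := (le_max_left _ _).trans hl.1
    omega
  rw [e1, e2, e3, e4, pow_succ]
  ring

end PolyominoAF

/-! ### The generating function behind `R` and `Q` -/

namespace PolyominoAF

open Finset Polynomial

/-- Up to sign these are the coefficients of the characteristic polynomial of the transfer matrix
below: its trace, minus the sum of its principal 2 × 2 minors, and its determinant. -/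
noncomputable def kerA : ℤ[X] := X + 3 * X ^ 2 + 3 * X ^ 3
noncomputable def kerB : ℤ[X] := -(3 * X ^ 3 - X ^ 4 + 6 * X ^ 5 + 2 * X ^ 6)
noncomputable def kerC : ℤ[X] := 3 * X ^ 6 + X ^ 7

/-- The polynomial `A t + B t ^ 2 + C t ^ 3` in `t`. -/
noncomputable def kernel : ℤ[X][X] := C kerA * X + (C kerC * X ^ 3 + C kerB * X ^ 2)

/-- The coefficient of `t ^ n` in `1 / (1 - A t - B t ^ 2 - C t ^ 3)`. -/
noncomputable def W (n : ℕ) : ℤ[X] := ∑ i ∈ range (n + 1), (kernel ^ i).coeff n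

theorem coeff_kernel_pow_of_lt {n i : ℕ} (h : n < i) : (kernel ^ i).coeff n = 0 := by
  have : kernel = X * (C kerA + (C kerC * X ^ 2 + C kerB * X)) := by unfold kernel; ring
  rw [this, mul_pow, coeff_X_pow_mul', if_neg (by omega)]

theorem W_eq_sum_range {n N : ℕ} (h : n < N) : W n = ∑ i ∈ range N, (kernel ^ i).coeff n := by
  refine sum_subset (range_subset_range.2 h) fun i _ hi => ?_
  exact coeff_kernel_pow_of_lt (by simpa using hi)

theorem coeff_mul_kernel (p : ℤ[X][X]) (n : ℕ) : (p * kernel).coeff (n + 1) =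
    kerA * p.coeff n + ((if 1 ≤ n then kerB * p.coeff (n - 1) else 0) +
      (if 2 ≤ n then kerC * p.coeff (n - 2) else 0)) := by
  have e : p * kernel = C kerA * (p * X ^ 1) + (C kerB * (p * X ^ 2) + C kerC * (p * X ^ 3)) := by
    unfold kernel; ring
  rw [e]
  simp only [coeff_add, coeff_C_mul, coeff_mul_X_pow']
  rw [if_pos (by omega), mul_ite, mul_ite, mul_zero, mul_zero]
  congr 2
  · split_ifs <;> first | omega | rfl
  · split_ifs <;> first | omega | rfl

theorem W_zero : W 0 = 1 := by simp [W]

/-- This is `1 / (1 - K) = 1 + K / (1 - K)` for `K = kernel`. As `K` is divisible by `t`, every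
coefficient of the geometric series is a finite sum that may be truncated at any later index. -/
theorem W_succ (n : ℕ) : W (n + 1) = kerA * W n + ((if 1 ≤ n then kerB * W (n - 1) else 0) +
      (if 2 ≤ n then kerC * W (n - 2) else 0)) := by
  rw [W, sum_range_succ']
  simp only [pow_succ, coeff_mul_kernel, sum_add_distrib, ← mul_sum]
  rw [← W, pow_zero, coeff_one, if_neg (by omega), add_zero]
  congr 2
  · split_ifs with h
    · rw [← mul_sum, ← W_eq_sum_range (by omega)]
    · simp
  · split_ifs with h
    · rw [← mul_sum, ← W_eq_sum_range (by omega)]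
    · simp

theorem W_add_three (n : ℕ) :
    W (n + 3) = kerA * W (n + 2) + (kerB * W (n + 1) + kerC * W n) := by
  rw [W_succ, if_pos (by omega), if_pos (by omega)]
  rfl

theorem W_one : W 1 = kerA := by
  rw [W_succ, W_zero]; simp

theorem W_two : W 2 = kerA * W 1 + kerB := by
  rw [W_succ]; simp [W_zero]

theorem coeff_linear_pow {R : Type*} [CommRing R] (c d : R) (N e : ℕ) :
    ((C c * X + C d : R[X]) ^ N).coeff e = N.choose e * c ^ e * d ^ (N - e) := by
  have : (C c * X + C d : R[X]) = (X + C d : R[X]).comp (C c * X) := by simp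
  rw [this, ← pow_comp, comp_C_mul_X_coeff, coeff_X_add_C_pow]
  ring

/-- Among the `i` factors let `j` contribute `A t`, `a` contribute `C t ^ 3` and `b` contribute `B t
^ 2`. Solving `j + a + b = i` and `j + 3 a + 2 b = n` gives `a = n + j - 2 i` and `b = 3 i - 2 j -
n`, the `alpha` and `beta` of the formula. -/
theorem coeff_kernel_pow (n i : ℕ) : (kernel ^ i).coeff n = ∑ j ∈ range (i + 1),
    if 2 * i ≤ n + j ∧ n + 2 * j ≤ 3 * i then
      (i.choose j * (i - j).choose (n + j - 2 * i) : ℤ[X]) * (kerA ^ j *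
        kerC ^ (n + j - 2 * i) * kerB ^ (3 * i - (n + 2 * j))) else 0 := by
  unfold kernel
  rw [add_pow, finsetSum_coeff]
  refine sum_congr rfl fun j hj => ?_
  rw [mem_range] at hj
  have e : (C kerA * X) ^ j * (C kerC * X ^ 3 + C kerB * X ^ 2) ^ (i - j) * (i.choose j : ℤ[X][X]) =
      C ((i.choose j : ℤ[X]) * kerA ^ j) * ((C kerC * X + C kerB) ^ (i - j) *
        X ^ (j + 2 * (i - j))) := by
    have : C kerC * X ^ 3 + C kerB * X ^ 2 = (C kerC * X + C kerB) * X ^ 2 := by ring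
    rw [this, mul_pow, mul_pow, C_mul, C_pow, map_natCast]
    ring
  rw [e, coeff_C_mul, coeff_mul_X_pow', coeff_linear_pow]
  by_cases h1 : 2 * i ≤ n + j
  · rw [if_pos (by omega)]
    have e1 : n - (j + 2 * (i - j)) = n + j - 2 * i := by omega
    rw [e1]
    by_cases h2 : n + 2 * j ≤ 3 * i
    · rw [if_pos ⟨h1, h2⟩]
      have e2 : i - j - (n + j - 2 * i) = 3 * i - (n + 2 * j) := by omega
      rw [e2]
      ring
    · rw [if_neg (by omega), Nat.choose_eq_zero_of_lt (n := i - j) (by omega)]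
      simp
  · rw [if_neg (by omega), if_neg (by omega)]
    simp

theorem kerA_pow (j : ℕ) : kerA ^ j = X ^ j * ∑ k ∈ range (j + 1), ∑ r ∈ range (k + 1),
    C (j.choose k * k.choose r * 3 ^ k : ℤ) * X ^ (k + r) := by
  have e : kerA = X * (3 * X * (X + 1) + 1) := by unfold kerA; ring
  rw [e, mul_pow, add_pow]
  congr 1
  refine sum_congr rfl fun k hk => ?_
  rw [mul_pow, mul_pow, add_pow]
  simp only [one_pow, mul_one, mul_sum, sum_mul]
  refine sum_congr rfl fun r hr => ?_
  simp only [C_mul, map_natCast, C_pow, map_ofNat]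
  ring

theorem kerC_pow (a : ℕ) : kerC ^ a = X ^ (3 * a) * ∑ m ∈ range (a + 1),
    C (a.choose m * 3 ^ (a - m) : ℤ) * X ^ (3 * a + m) := by
  have e : kerC = X ^ 3 * (X ^ 3 * (X + 3)) := by unfold kerC; ring
  rw [e, mul_pow, mul_pow, add_pow, ← pow_mul]
  congr 1
  rw [mul_sum]
  refine sum_congr rfl fun m hm => ?_
  simp only [C_mul, map_natCast, C_pow, map_ofNat]
  ring

/-- Here `s` factors contribute `3 X`, `l` factors `-X ^ 2`, and the others `2 X ^ 3 (X + 3)`. The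
powers of `X + 3` stay unexpanded: only one coefficient of them is needed, the one with index
`theta`. -/
theorem kerB_pow (b : ℕ) : kerB ^ b = X ^ (2 * b) * ∑ s ∈ range (b + 1), ∑ l ∈ range (b - s + 1),
    C (b.choose s * (b - s).choose l * (-1) ^ (b + l) * 2 ^ (b - s - l) * 3 ^ s : ℤ) *
      (X ^ (s + 2 * l + 3 * (b - s - l)) * (X + C 3) ^ (b - s - l)) := by
  have e : kerB = X ^ 2 * (-1 * (3 * X + (-X ^ 2 + X ^ 3 * (2 * (X + C 3))))) := by
    unfold kerB
    simp only [map_ofNat]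
    ring
  rw [e, mul_pow, mul_pow, add_pow, ← pow_mul]
  congr 1
  rw [mul_sum]
  refine sum_congr rfl fun s hs => ?_
  rw [add_pow, mul_sum, sum_mul, mul_sum]
  refine sum_congr rfl fun l hl => ?_
  simp only [C_mul, map_natCast, C_pow, map_ofNat, map_neg, map_one]
  rw [neg_pow (X ^ 2 : ℤ[X]), mul_pow (X ^ 3), mul_pow 2]
  ring

/-- The powers of `X` pulled out of the three factors multiply to `X ^ (j + 3 a + 2 b) = X ^ n`,
which is why the exponent is counted from `n`. -/
theorem coeff_ker_prod (n q i j a b : ℕ) (hn : n = j + 3 * a + 2 * b) :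
    ((i.choose j * (i - j).choose a : ℤ[X]) * (kerA ^ j * kerC ^ a * kerB ^ b)).coeff (n + q) =
      natSum q i j a b := by
  rw [kerA_pow, kerC_pow, kerB_pow]
  have e : ∀ u v w : ℤ[X], (i.choose j * (i - j).choose a : ℤ[X]) *
      (X ^ j * u * (X ^ (3 * a) * v) * (X ^ (2 * b) * w)) =
      X ^ n * (u * (v * (w * C (i.choose j * (i - j).choose a : ℤ)))) := by
    intro u v w
    rw [hn]
    simp only [C_mul, map_natCast]
    ring
  rw [e, add_comm n q, coeff_X_pow_mul]
  unfold natSum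
  simp only [sum_mul]
  simp only [mul_sum, finsetSum_coeff]
  refine sum_congr rfl fun k _ => sum_congr rfl fun r _ => sum_congr rfl fun m _ =>
    sum_congr rfl fun s _ => sum_congr rfl fun l _ => ?_
  have e2 : ∀ (c c1 c2 c3 : ℤ) (u : ℤ[X]) (x1 x2 x3 : ℕ),
      C c1 * X ^ x1 * (C c2 * X ^ x2 * (C c3 * (X ^ x3 * u) * C c)) =
      C (c * c1 * c2 * c3) * (u * X ^ (x1 + x2 + x3)) := by
    intros
    simp only [C_mul]
    ring
  rw [e2, coeff_C_mul, coeff_mul_X_pow', natTerm]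
  have e3 : k + r + (3 * a + m) + (s + 2 * l + 3 * (b - s - l)) =
    k + r + 3 * a + m + s + 2 * l + 3 * (b - s - l) := by ring
  rw [e3]
  split_ifs with h
  · rw [coeff_X_add_C_pow]
    ring
  · simp

theorem coeffR_eq_coeff_W (n q : ℕ) : coeffR n q = (W n).coeff (n + q) := by
  rw [coeffR_eq, W, finsetSum_coeff]
  refine sum_congr rfl fun i _ => ?_
  rw [coeff_kernel_pow, finsetSum_coeff]
  refine sum_congr rfl fun j hj => ?_
  rw [mem_range] at hj
  split_ifs with h
  · rw [coeff_ker_prod _ _ _ _ _ _ (by omega)]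
  · simp

/-- The degree bound shows that cutting the sums over `q` at `2 n` loses nothing. -/
theorem exists_W_eq (n : ℕ) : ∃ p : ℤ[X], W n = X ^ n * p ∧ p.natDegree ≤ 2 * n := by
  induction n using Nat.strong_induction_on with
  | _ n ih =>
    match n, ih with
    | 0, _ => exact ⟨1, by simp [W_zero], by simp⟩
    | 1, _ =>
      refine ⟨1 + 3 * X + 3 * X ^ 2, by rw [W_one, kerA]; ring, by compute_degree⟩
    | 2, _ =>
      refine ⟨(1 + 3 * X + 3 * X ^ 2) ^ 2 - (3 * X - X ^ 2 + 6 * X ^ 3 + 2 * X ^ 4), by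
        rw [W_two, W_one, kerA, kerB]; ring, ?_⟩
      compute_degree
    | n + 3, ih =>
      obtain ⟨p, hp, hp'⟩ := ih n (by omega)
      obtain ⟨p1, hp1, hp1'⟩ := ih (n + 1) (by omega)
      obtain ⟨p2, hp2, hp2'⟩ := ih (n + 2) (by omega)
      refine ⟨(1 + 3 * X + 3 * X ^ 2) * p2 + (-(3 * X - X ^ 2 + 6 * X ^ 3 + 2 * X ^ 4) * p1 +
        (3 * X ^ 3 + X ^ 4) * p), by
          rw [W_add_three, hp, hp1, hp2, kerA, kerB, kerC]; ring, ?_⟩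
      refine natDegree_add_le_of_degree_le ?_ (natDegree_add_le_of_degree_le ?_ ?_)
      · refine (natDegree_mul_le_of_le (m := 2) (by compute_degree) hp2').trans (by omega)
      · refine (natDegree_mul_le_of_le (m := 4) (by compute_degree) hp1').trans (by omega)
      · refine (natDegree_mul_le_of_le (m := 4) (by compute_degree) hp').trans (by omega)

/-- Modulo `X ^ 2` the recurrence for `W n / X ^ n` preserves `1 + 3 X`, since `(1 + 3 X) ^ 2 - 3 X
(1 + 3 X)` is `1 + 3 X` again. -/
theorem exists_W_succ_eq (n : ℕ) :
    ∃ p : ℤ[X], W (n + 1) = X ^ (n + 1) * (1 + 3 * X + X ^ 2 * p) := by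
  induction n using Nat.strong_induction_on with
  | _ n ih =>
    match n, ih with
    | 0, _ => exact ⟨3, by rw [W_one, kerA]; ring⟩
    | 1, _ => exact ⟨16 + 12 * X + 7 * X ^ 2, by rw [W_two, W_one, kerA, kerB]; ring⟩
    | 2, _ =>
      exact ⟨20 + 60 * X + 75 * X ^ 2 + 33 * X ^ 3 + 15 * X ^ 4, by
        rw [W_add_three, W_two, W_one, W_zero, kerA, kerB, kerC]; ring⟩
    | n + 3, ih =>
      obtain ⟨p, hp⟩ := ih n (by omega)
      obtain ⟨p1, hp1⟩ := ih (n + 1) (by omega)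
      obtain ⟨p2, hp2⟩ := ih (n + 2) (by omega)
      refine ⟨(1 + 3 * X + 3 * X ^ 2) * p2 - (3 * X - X ^ 2 + 6 * X ^ 3 + 2 * X ^ 4) * p1 +
        (1 + 3 * X) * (4 - 6 * X - 2 * X ^ 2) + (3 * X + X ^ 2) * (1 + 3 * X + X ^ 2 * p), ?_⟩
      rw [W_add_three, hp, hp1, hp2, kerA, kerB, kerC]
      ring

theorem sum_Icc_two_coeff {p : ℤ[X]} {N : ℕ} (hN : 1 ≤ N) (hp : p.natDegree ≤ N) :
    ∑ q ∈ Icc 2 N, C (p.coeff q) * X ^ q = p - C (p.coeff 0) - C (p.coeff 1) * X := by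
  have e := p.as_sum_range_C_mul_X_pow' (Nat.lt_succ_of_le hp)
  have h : range (N + 1) = insert 0 (insert 1 (Icc 2 N)) := by
    ext x
    simp only [mem_range, mem_insert, mem_Icc]
    omega
  rw [Nat.succ_eq_add_one, h, sum_insert (by simp), sum_insert (by simp), pow_zero, mul_one,
    pow_one] at e
  linear_combination -e

/-- `R n + Q n` and the two remaining terms of the formula, in terms of `W`. -/
theorem R_add_Q_eq (n : ℕ) :
    R (n + 1) + Q (n + 1) + 3 * X ^ (n + 2) + X ^ (n + 1) = W (n + 1) - X ^ 3 * W n := by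
  obtain ⟨p, hp, hpd⟩ := exists_W_eq (n + 1)
  obtain ⟨p', hp', hpd'⟩ := exists_W_eq n
  obtain ⟨r, hr⟩ := exists_W_succ_eq n
  have hpr : p = 1 + 3 * X + X ^ 2 * r :=
    mul_left_cancel₀ (pow_ne_zero (n + 1) X_ne_zero) (hp.symm.trans hr)
  have hd : (p - X ^ 2 * p').natDegree ≤ 2 * (n + 1) := by
    refine (natDegree_sub_le _ _).trans (max_le hpd ?_)
    refine (natDegree_mul_le_of_le (m := 2) (by compute_degree) hpd').trans (by omega)
  have key := sum_Icc_two_coeff (by omega) hd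
  have h0 : (p - X ^ 2 * p').coeff 0 = 1 := by
    rw [hpr]
    simp
  have h1 : (p - X ^ 2 * p').coeff 1 = 3 := by
    have : p - X ^ 2 * p' = C 1 + C 3 * X + X ^ 2 * (r - p') := by
      rw [hpr, map_one, map_ofNat]
      ring
    rw [this, coeff_add, coeff_X_pow_mul', coeff_add, coeff_C_mul]
    simp [coeff_one]
  rw [h0, h1] at key
  have hRQ : R (n + 1) + Q (n + 1) = X ^ (n + 1) *
      ∑ q ∈ Icc 2 (2 * (n + 1)), C ((p - X ^ 2 * p').coeff q) * X ^ q := by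
    rw [R, Q, ← mul_add, ← sum_add_distrib]
    congr 1
    refine sum_congr rfl fun q hq => ?_
    -- As `q ≥ 2`, the coefficient of `X ^ 2 * p'` at `q` is that of `p'` at `t = q - 2`.
    obtain ⟨t, rfl⟩ := Nat.exists_eq_add_of_le (mem_Icc.1 hq).1
    have e : ((n + 1 : ℕ) : ℤ) - 1 = (n : ℕ) := by push_cast; ring
    have e' : ((2 + t : ℕ) : ℤ) - 2 = (t : ℕ) := by push_cast; ring
    rw [coeffQ_eq, e, e', coeffR_eq_coeff_W, coeffR_eq_coeff_W, hp, hp', add_comm (n + 1),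
      coeff_X_pow_mul, add_comm n t, coeff_X_pow_mul, coeff_sub, add_comm 2 t, coeff_X_pow_mul,
      ← add_mul, ← C_add, sub_eq_add_neg]
  rw [hRQ, key, hp, hp']
  simp only [map_ofNat, map_one]
  ring

end PolyominoAF

/-! ### Words, the automaton, and the two bounds on the cost -/

namespace PolyominoAF

/-- The kinds of edges of the part of the graph between two consecutive even columns. The edges
`cu`, `cv` lead to the odd column, `p` and `q` are the rungs of the odd and the even column, `uu`
and `vv` join these columns, and the rest are the edges at the `w`'s and `z`'s. -/
inductive Kind
  | cu | cv | p | q | uu | vv | ww | zz | wp | wq | zp | zq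
  deriving DecidableEq

instance : Fintype Kind :=
  ⟨{.cu, .cv, .p, .q, .uu, .vv, .ww, .zz, .wp, .wq, .zp, .zq}, fun κ => by cases κ <;> decide⟩

theorem Kind.sum_eq {M : Type*} [AddCommMonoid M] (f : Kind → M) : ∑ κ, f κ =
    f .cu + (f .cv + (f .p + (f .q + (f .uu + (f .vv + (f .ww + (f .zz + (f .wp + (f .wq +
      (f .zp + f .zq)))))))))) := by
  have h : (Finset.univ : Finset Kind) =
    {.cu, .cv, .p, .q, .uu, .vv, .ww, .zz, .wp, .wq, .zp, .zq} := rfl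
  rw [h]
  repeat rw [Finset.sum_insert (by decide)]
  rw [Finset.sum_singleton]

/-- The possible intersections of a perfect matching with such a part. -/
inductive Letter
  | V | H | U | D | X | a | b | d
  deriving DecidableEq

instance : Fintype Letter := ⟨{.V, .H, .U, .D, .X, .a, .b, .d}, fun ℓ => by cases ℓ <;> decide⟩

namespace Letter

/-- Whether the edges to the odd column are used. -/
def src : Letter → Bool
  | b | d => true
  | _ => false

/-- Whether the edges leaving the even column to the right are used. -/
def tgt : Letter → Bool
  | a | b => true
  | _ => false

/-- The edges that belong to a letter. -/
def has (ℓ : Letter) : Kind → Bool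
  | .cu | .cv => ℓ = b || ℓ = d
  | .p => ℓ = V || ℓ = a
  | .q => ℓ = V || ℓ = d
  | .uu => ℓ = H || ℓ = U
  | .vv => ℓ = H || ℓ = D
  | .ww => !(ℓ = D || ℓ = X)
  | .zz => !(ℓ = U || ℓ = X)
  | .wp | .wq => ℓ = D || ℓ = X
  | .zp | .zq => ℓ = U || ℓ = X

theorem eq_of_has_eq {ℓ m : Letter} (h : ∀ κ, ℓ.has κ = m.has κ) : ℓ = m := by
  revert ℓ m; decide

end Letter

/-- A matching is coded by `c : Bool` (is `u₀v₀` missing?) and one letter for each part. -/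
structure Word where
  start : Bool
  letter : ℕ → Letter

namespace Word

/-- Whether the edges between column `2 k` and column `2 k + 1` are used. -/
def cross (w : Word) : ℕ → Bool
  | 0 => w.start
  | k + 1 => (w.letter k).tgt

def Valid (w : Word) (n : ℕ) : Prop := ∀ i < n, (w.letter i).src = w.cross i

/-- Letters from position `n` on carry no information, so words are only compared below `n`. -/
def AgreeOn (w w' : Word) (n : ℕ) : Prop := w.start = w'.start ∧ ∀ i < n, w.letter i = w'.letter i

/-- The word avoids a set of edges, described by `s₀` (for `u₀v₀`) and `s`. -/
def Avoids (w : Word) (n : ℕ) (s₀ : Prop) (s : ℕ → Kind → Prop) : Prop :=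
  (w.start = false → ¬ s₀) ∧ ∀ i < n, ∀ κ, (w.letter i).has κ = true → ¬ s i κ

end Word

/-- States of the automaton computing the anti-forcing number. -/
inductive State
  | P | N | O
  deriving DecidableEq

instance : Fintype State := ⟨{.P, .N, .O}, fun st => by cases st <;> decide⟩

namespace State

/-- In state `O` the word crosses to the next part. In `P` and `N` it does not: in `P` the chosen
cut may leave alive a deviating matching that crosses here, in `N` it leaves none. A deviation left
alive in `P` has to be met later or fails at the right end, where nothing can cross. -/
def init (c : Bool) : State := if c then O else P

def next (st : State) (ℓ : Letter) : State :=
  match ℓ with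
  | .V | .d => P
  | .H => st
  | .U | .D | .X => N
  | .a | .b => O

def cross (st : State) : Bool := st = O

def cost (st : State) : Letter → ℕ
  | .V => if st = P then 3 else 2
  | .H => 3
  | .U | .D | .X => 2
  | .a => if st = P then 4 else 3
  | .b => 1
  | .d => 0

/-- A locally chosen set of edges meeting all other matchings. -/
def cut (st : State) : Letter → Kind → Bool
  | .V, κ => κ = .uu || κ = .wp || (st = P && κ = .cu)
  | .H, κ => κ = .wp || κ = .zp || (if st = P then κ = .q else κ = .p)
  | .U, κ => κ = .zz || κ = .wp
  | .D, κ => κ = .ww || κ = .zp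
  | .X, κ => κ = .ww || κ = .zz
  | .a, κ => κ = .uu || κ = .wp || κ = .q || (st = P && κ = .cu)
  | .b, κ => κ = .q
  | .d, _ => false

end State

namespace Word
open State

def state (w : Word) : ℕ → State
  | 0 => init w.start
  | k + 1 => (w.state k).next (w.letter k)

def cost (w : Word) : ℕ → ℕ
  | 0 => w.start.toNat
  | k + 1 => w.cost k + (w.state k).cost (w.letter k)

theorem cross_state {w : Word} {n k : ℕ} (hw : w.Valid n) (hk : k ≤ n) :
    (w.state k).cross = w.cross k := by
  induction k with
  | zero => simp only [state, cross]; cases w.start <;> rfl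
  | succ k ih =>
    have h := hw k (by omega)
    rw [← ih (by omega)] at h
    simp only [state, cross]
    clear ih
    generalize w.state k = st at *
    generalize w.letter k = ℓ at *
    revert st ℓ; decide

/-- The cut avoids the letter and has size the cost. A letter avoiding the cut is either the given
one, or starts or continues a crossing deviation, and then the new state is `P`. -/
theorem cut_step : ∀ (st : State) (m : Letter), m.src = st.cross →
    (∀ κ, st.cut m κ = true → m.has κ = false) ∧
    (∑ κ, (st.cut m κ).toNat = st.cost m) ∧
    (∀ ℓ : Letter, (∀ κ, ℓ.has κ = true → st.cut m κ = false) →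
      (ℓ.src = st.cross → ℓ = m ∨ (st.next m = P ∧ ℓ.tgt = true)) ∧
      (st = P → ℓ.src = true → st.next m = P ∧ ℓ.tgt = true)) := by
  decide

/-- Reading from the left, the other word either still agrees, or it crosses while the state is `P`.
The second case cannot persist up to position `n`, where no word crosses. -/
theorem eq_of_avoids_cut {w w' : Word} {n : ℕ} (hw : w.Valid n) (hw' : w'.Valid n)
    (hc : w'.cross n = false)
    (ha : w'.Avoids n (w.start = true) fun i κ => (w.state i).cut (w.letter i) κ = true) :
    w'.AgreeOn w n := by
  have key : ∀ k ≤ n, (w'.AgreeOn w k ∧ w'.cross k = w.cross k) ∨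
      (w.state k = P ∧ w'.cross k = true) := by
    intro k
    induction k with
    | zero =>
      intro _
      have := ha.1
      simp only [AgreeOn, cross, state]
      revert this
      cases w.start <;> cases w'.start <;> simp [init]
    | succ k ih =>
      intro hk
      have hst := cross_state hw (k := k) (by omega)
      have h1 := hw k (by omega)
      have h2 := hw' k (by omega)
      have h3 := (cut_step (w.state k) (w.letter k) (by rw [hst, h1])).2.2 (w'.letter k)
        fun κ hκ => by simpa using ha.2 k (by omega) κ hκ
      rcases ih (by omega) with ⟨hag, hcr⟩ | ⟨hP, hcr⟩
      · rcases h3.1 (by rw [h2, hcr, hst]) with h | h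
        · left
          refine ⟨⟨hag.1, fun i hi => ?_⟩, by simp [cross, h]⟩
          rcases Nat.lt_succ_iff_lt_or_eq.1 hi with hi | rfl
          · exact hag.2 i hi
          · exact h
        · exact Or.inr h
      · exact Or.inr (h3.2 hP (by rw [h2, hcr]))
  rcases key n le_rfl with h | ⟨_, h⟩
  · exact h.1
  · simp [hc] at h

/-- The amount by which a set of edges meeting all matchings but one has to exceed the cost so far,
where `p` is `1` if some deviating matching has not been met yet, and `0` otherwise. -/
def slack (st : State) (p : ℤ) : ℤ :=
  match st with
  | P => 1 - p
  | N => 0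
  | O => -3 * p

/-- The local step of the lower bound. `p` and `p'` say whether there is a deviating matching
before and after the step. -/
theorem cost_step (st : State) (m : Letter) (hm : m.src = st.cross) (y : Kind → ℤ) (p p' : ℤ)
    (hp : 0 ≤ p) (hp1 : p ≤ 1) (hy : ∀ κ, 0 ≤ y κ)
    (hy0 : ∀ κ, m.has κ = true → y κ = 0)
    (h1 : ∀ ℓ : Letter, ℓ.src = st.cross → ℓ.tgt = m.tgt → ℓ ≠ m →
      1 ≤ ∑ κ, if ℓ.has κ then y κ else 0)
    (h2 : ∀ ℓ : Letter, ℓ.src = st.cross → ℓ.tgt ≠ m.tgt →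
      1 ≤ (∑ κ, if ℓ.has κ then y κ else 0) + p')
    (h3 : ∀ ℓ : Letter, ℓ.src ≠ st.cross → ℓ.tgt = m.tgt →
      p ≤ ∑ κ, if ℓ.has κ then y κ else 0)
    (h4 : ∀ ℓ : Letter, ℓ.src ≠ st.cross → ℓ.tgt ≠ m.tgt →
      p ≤ (∑ κ, if ℓ.has κ then y κ else 0) + p') :
    st.cost m + slack (st.next m) p' ≤ (∑ κ, y κ) + slack st p := by
  -- The four hypotheses, together with the trivial bound for `ℓ = m`, become one inequality per
  -- letter.
  have hall : ∀ ℓ : Letter,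
      (if ℓ.src = st.cross then (1 : ℤ) else p) ≤ (∑ κ, if ℓ.has κ then y κ else 0) +
        (if ℓ.tgt = m.tgt then (if ℓ = m then 1 else 0) else p') := by
    intro ℓ
    have h0 : 0 ≤ ∑ κ, if ℓ.has κ then y κ else 0 :=
      Finset.sum_nonneg fun κ _ => by split_ifs <;> simp [hy]
    split_ifs
    · omega
    · simpa using h1 ℓ ‹_› ‹_› ‹_›
    · exact h2 ℓ ‹_› ‹_›
    · omega
    · simpa using h3 ℓ ‹_› ‹_›
    · exact h4 ℓ ‹_› ‹_›
  clear h1 h2 h3 h4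
  have hV := hall .V
  have hH := hall .H
  have hU := hall .U
  have hD := hall .D
  have hX := hall .X
  have ha := hall .a
  have hb := hall .b
  have hd := hall .d
  clear hall
  simp only [Kind.sum_eq] at *
  have y1 := hy .cu
  have y2 := hy .cv
  have y3 := hy .p
  have y4 := hy .q
  have y5 := hy .uu
  have y6 := hy .vv
  have y7 := hy .ww
  have y8 := hy .zz
  have y9 := hy .wp
  have y10 := hy .wq
  have y11 := hy .zp
  have y12 := hy .zq
  have z1 := hy0 .cu
  have z2 := hy0 .cv
  have z3 := hy0 .p
  have z4 := hy0 .q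
  have z5 := hy0 .uu
  have z6 := hy0 .vv
  have z7 := hy0 .ww
  have z8 := hy0 .zz
  clear hy hy0
  -- For fixed state and letter this is a system of linear integer inequalities in `y`, `p`, `p'`.
  cases st <;> cases m <;> first
    | exact absurd hm (by decide)
    | simp [Letter.src, Letter.tgt, Letter.has, State.cost, State.next, State.cross, slack] at *
      omega

/-- The word `w'` up to position `k`, followed by `ℓ`, followed by the rest of `w`. -/
def splice (w' : Word) (k : ℕ) (ℓ : Letter) (w : Word) : Word :=
  ⟨w'.start, fun i => if i < k then w'.letter i else if i = k then ℓ else w.letter i⟩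

section splice

variable {w w' : Word} {k n : ℕ} {ℓ : Letter} {s₀ : Prop} {s : ℕ → Kind → Prop}

theorem splice_cross_of_le {i : ℕ} (h : i ≤ k) : (splice w' k ℓ w).cross i = w'.cross i := by
  cases i with
  | zero => rfl
  | succ i => simp [cross, splice, Nat.lt_of_succ_le h]

theorem splice_cross_succ : (splice w' k ℓ w).cross (k + 1) = ℓ.tgt := by
  simp [cross, splice]

theorem splice_cross_of_lt {i : ℕ} (ht : ℓ.tgt = w.cross (k + 1)) (h : k < i) :
    (splice w' k ℓ w).cross i = w.cross i := by
  rcases Nat.lt_or_eq_of_le h with h | rfl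
  · obtain ⟨i, rfl⟩ := Nat.exists_eq_add_of_lt h
    simp [cross, splice, show ¬ (k + 1 + i < k) by omega, show ¬ (k + 1 + i = k) by omega]
  · rw [← ht]
    exact splice_cross_succ

theorem splice_valid_succ (hw' : w'.Valid k) (hs : ℓ.src = w'.cross k) :
    (splice w' k ℓ w).Valid (k + 1) := by
  intro i hi
  rw [splice_cross_of_le (by omega)]
  rcases Nat.lt_succ_iff_lt_or_eq.1 hi with hi | rfl
  · simpa [splice, hi] using hw' i hi
  · simpa [splice] using hs

theorem splice_valid (hw' : w'.Valid k) (hs : ℓ.src = w'.cross k) (hw : w.Valid n)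
    (ht : ℓ.tgt = w.cross (k + 1)) : (splice w' k ℓ w).Valid n := by
  intro i hi
  rcases Nat.lt_or_ge k i with h | h
  · rw [splice_cross_of_lt ht h]
    simpa [splice, show ¬ i < k by omega, show ¬ i = k by omega] using hw i hi
  · exact splice_valid_succ hw' hs i (by omega)

theorem splice_avoids_succ (hw' : w'.Avoids k s₀ s) (hℓ : ∀ κ, ℓ.has κ = true → ¬ s k κ) :
    (splice w' k ℓ w).Avoids (k + 1) s₀ s := by
  refine ⟨hw'.1, fun i hi κ => ?_⟩
  rcases Nat.lt_succ_iff_lt_or_eq.1 hi with hi | rfl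
  · simpa [splice, hi] using hw'.2 i hi κ
  · simpa [splice] using hℓ κ

theorem splice_avoids (hw' : w'.Avoids k s₀ s) (hℓ : ∀ κ, ℓ.has κ = true → ¬ s k κ)
    (hw : w.Avoids n s₀ s) : (splice w' k ℓ w).Avoids n s₀ s := by
  refine ⟨hw'.1, fun i hi κ => ?_⟩
  rcases Nat.lt_or_ge k i with h | h
  · simpa [splice, show ¬ i < k by omega, show ¬ i = k by omega] using hw.2 i hi κ
  · exact (splice_avoids_succ hw' hℓ).2 i (by omega) κ

end splice

theorem Valid.mono {w : Word} {k n : ℕ} (h : w.Valid n) (hk : k ≤ n) : w.Valid k :=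
  fun i hi => h i (by omega)

theorem Avoids.mono {w : Word} {k n : ℕ} {s₀ : Prop} {s : ℕ → Kind → Prop}
    (h : w.Avoids n s₀ s) (hk : k ≤ n) : w.Avoids k s₀ s :=
  ⟨h.1, fun i hi => h.2 i (by omega)⟩

open Classical in
theorem one_le_sum_has {ℓ : Letter} {s : Kind → Prop} (h : ¬ ∀ κ, ℓ.has κ = true → ¬ s κ) :
    (1 : ℤ) ≤ ∑ κ, if ℓ.has κ then (if s κ then 1 else 0) else 0 := by
  push Not at h
  obtain ⟨κ, h1, h2⟩ := h
  refine le_trans ?_ (Finset.single_le_sum (fun κ _ => ?_) (Finset.mem_univ κ))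
  · simp [h1, h2]
  · split_ifs <;> simp

-- The invariant compares cost plus slack with the number of edges met so far. Its steps rest on
-- splicing: a prefix avoiding the set, a letter avoiding it, and the tail of `w` form a matching
-- avoiding it when the ends fit, and such a matching must be `w`.
open Classical in
theorem cost_le_of_meets {w : Word} {n : ℕ} {s₀ : Prop} {s : ℕ → Kind → Prop} (hw : w.Valid n)
    (hav : w.Avoids n s₀ s) (hn : w.cross n = false)
    (hhit : ∀ w' : Word, w'.Valid n → w'.cross n = false → w'.Avoids n s₀ s → w'.AgreeOn w n) :
    w.cost n ≤ (if s₀ then 1 else 0) + ∑ i ∈ Finset.range n, ∑ κ, if s i κ then 1 else 0 := by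
  -- A deviation still alive at `k` is a prefix that avoids the set but crosses differently from
  -- `w`.
  let dev : ℕ → Prop := fun k => ∃ w' : Word, w'.Valid k ∧ w'.cross k ≠ w.cross k ∧ w'.Avoids k s₀ s
  have key : ∀ k ≤ n, (w.cost k : ℤ) + slack (w.state k) (if dev k then 1 else 0) ≤
      (if s₀ then 1 else 0) + ∑ i ∈ Finset.range k, ∑ κ, if s i κ then 1 else 0 := by
    intro k
    induction k with
    | zero =>
      intro _
      have h0 := hav.1
      cases hstart : w.start with
      | false =>
        have hdev : dev 0 := ⟨⟨true, w.letter⟩, fun i hi => by omega, by simp [cross, hstart],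
          by simp, fun i hi => by omega⟩
        simp only [cost, state, hstart, init, slack, hdev]
        split_ifs <;> simp
      | true =>
        by_cases hs : s₀
        · simp only [cost, state, hstart, init, slack, hs]
          split_ifs <;> simp
        · have hdev : dev 0 := ⟨⟨false, w.letter⟩, fun i hi => by omega, by simp [cross, hstart],
            fun _ => hs, fun i hi => by omega⟩
          simp [cost, state, hstart, init, slack, hs, hdev]
    | succ k ih =>
      intro hk
      have hst := cross_state hw (k := k) (by omega)
      have hwk := hw.mono (k := k) (by omega)
      have havk := hav.mono (k := k) (by omega)
      have step := cost_step (w.state k) (w.letter k) (by rw [hst, hw k (by omega)])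
        (fun κ => if s k κ then 1 else 0) (if dev k then 1 else 0) (if dev (k + 1) then 1 else 0)
        (by split_ifs <;> simp) (by split_ifs <;> simp) (fun κ => by split_ifs <;> simp)
        (fun κ hκ => if_neg (hav.2 k (by omega) κ hκ))
        (fun ℓ hs ht hne => one_le_sum_has fun hℓ => hne ?_)
        (fun ℓ hs ht => ?_) (fun ℓ hs ht => ?_) (fun ℓ hs ht => ?_)
      · rw [Finset.sum_range_succ]
        simp only [cost, state]
        push_cast
        have := ih (by omega)
        linarith
      · have := (hhit (splice w k ℓ w) (splice_valid hwk (by rw [hs, hst]) hw ht)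
          (by rw [splice_cross_of_lt ht (by omega), hn]) (splice_avoids havk hℓ hav)).2 k (by omega)
        simpa [splice] using this
      · by_cases hℓ : ∀ κ, ℓ.has κ = true → ¬ s k κ
        · have : dev (k + 1) := ⟨splice w k ℓ w, splice_valid_succ hwk (by rw [hs, hst]),
            by rw [splice_cross_succ]; exact ht, splice_avoids_succ havk hℓ⟩
          rw [if_pos this]
          have : (0 : ℤ) ≤ ∑ κ, if ℓ.has κ then (if s k κ then 1 else 0) else 0 :=
            Finset.sum_nonneg fun κ _ => by split_ifs <;> simp
          linarith
        · have := one_le_sum_has hℓ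
          have h0 : (0 : ℤ) ≤ if dev (k + 1) then 1 else 0 := by split_ifs <;> simp
          linarith
      · by_cases hℓ : ∀ κ, ℓ.has κ = true → ¬ s k κ
        · rw [if_neg]
          · exact Finset.sum_nonneg fun κ _ => by split_ifs <;> simp
          -- A live deviation that rejoins `w` unmet would be a second matching avoiding the set.
          · rintro ⟨w', hv, hc, ha⟩
            have hs' : ℓ.src = w'.cross k := by
              rw [hst] at hs
              revert hs hc
              cases ℓ.src <;> cases w'.cross k <;> cases w.cross k <;> simp
            have hag := hhit (splice w' k ℓ w) (splice_valid hv hs' hw ht)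
              (by rw [splice_cross_of_lt ht (by omega), hn]) (splice_avoids ha hℓ hav)
            have := hag.2 k (by omega)
            simp only [splice, lt_irrefl, if_false, if_true] at this
            rw [this, hst] at hs
            exact hs (hw k (by omega))
        · refine le_trans ?_ (one_le_sum_has hℓ)
          split_ifs <;> simp
      · by_cases hℓ : ∀ κ, ℓ.has κ = true → ¬ s k κ
        · have h0 : (0 : ℤ) ≤ ∑ κ, if ℓ.has κ then (if s k κ then 1 else 0) else 0 :=
            Finset.sum_nonneg fun κ _ => by split_ifs <;> simp
          by_cases hd : dev k
          · obtain ⟨w', hv, hc, ha⟩ := hd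
            have hs' : ℓ.src = w'.cross k := by
              rw [hst] at hs
              revert hs hc
              cases ℓ.src <;> cases w'.cross k <;> cases w.cross k <;> simp
            have : dev (k + 1) := ⟨splice w' k ℓ w, splice_valid_succ hv hs',
              by rw [splice_cross_succ]; exact ht, splice_avoids_succ ha hℓ⟩
            rw [if_pos this]
            split_ifs <;> linarith
          · rw [if_neg hd]
            split_ifs <;> linarith
        · have := one_le_sum_has hℓ
          split_ifs <;> linarith
  have hfin := key n le_rfl
  -- As `w` does not cross at `n`, the last state is not `O`, the only state whose slack can be
  -- negative.
  have h1 : 0 ≤ slack (w.state n) (if dev n then 1 else 0) := by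
    have := cross_state hw le_rfl
    rw [hn] at this
    revert this
    cases w.state n <;> simp [State.cross, slack]
    split_ifs <;> simp
  zify
  linarith

end Word
end PolyominoAF

/-! ### The transfer matrix and its recurrence -/

namespace PolyominoAF

open Finset Polynomial

theorem Letter.sum_eq {M : Type*} [AddCommMonoid M] (f : Letter → M) : ∑ ℓ, f ℓ =
    f .V + (f .H + (f .U + (f .D + (f .X + (f .a + (f .b + f .d)))))) := by
  have h : (univ : Finset Letter) = {.V, .H, .U, .D, .X, .a, .b, .d} := rfl
  rw [h]
  repeat rw [sum_insert (by decide)]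
  rw [sum_singleton]

theorem State.sum_eq {M : Type*} [AddCommMonoid M] (f : State → M) : ∑ st, f st =
    f .P + (f .N + f .O) := by
  have h : (univ : Finset State) = {.P, .N, .O} := rfl
  rw [h]
  repeat rw [sum_insert (by decide)]
  rw [sum_singleton]

namespace Word

theorem AgreeOn.cross {w w' : Word} {n k : ℕ} (h : w.AgreeOn w' n) (hk : k ≤ n) :
    w.cross k = w'.cross k := by
  cases k with
  | zero => exact h.1
  | succ k => simp only [Word.cross, h.2 k (by omega)]

theorem AgreeOn.mono {w w' : Word} {n k : ℕ} (h : w.AgreeOn w' n) (hk : k ≤ n) :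
    w.AgreeOn w' k := ⟨h.1, fun i hi => h.2 i (by omega)⟩

theorem AgreeOn.symm {w w' : Word} {n : ℕ} (h : w.AgreeOn w' n) : w'.AgreeOn w n :=
  ⟨h.1.symm, fun i hi => (h.2 i hi).symm⟩

theorem AgreeOn.valid {w w' : Word} {n : ℕ} (h : w.AgreeOn w' n) (hw : w.Valid n) :
    w'.Valid n := by
  intro i hi
  rw [← h.2 i hi, ← h.cross (by omega)]
  exact hw i hi

theorem AgreeOn.valid_iff {w w' : Word} {n : ℕ} (h : w.AgreeOn w' n) :
    w.Valid n ↔ w'.Valid n := ⟨h.valid, h.symm.valid⟩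

theorem AgreeOn.state_cost {w w' : Word} {n : ℕ} (h : w.AgreeOn w' n) :
    w.state n = w'.state n ∧ w.cost n = w'.cost n := by
  induction n with
  | zero => simp only [state, cost, h.1, and_self]
  | succ n ih =>
    obtain ⟨h1, h2⟩ := ih (h.mono (by omega))
    simp only [state, cost, h1, h2, h.2 n (by omega), and_self]

/-- Expressing the fit of the next letter through the state alone makes the count a matrix
recursion. -/
theorem valid_succ_iff {w : Word} {n : ℕ} :
    w.Valid (n + 1) ↔ w.Valid n ∧ (w.letter n).src = (w.state n).cross := by
  constructor
  · intro h
    have h' := h.mono (Nat.le_succ n)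
    exact ⟨h', by rw [cross_state h' le_rfl, h n (by omega)]⟩
  · rintro ⟨h, h'⟩ i hi
    rcases Nat.lt_succ_iff_lt_or_eq.1 hi with hi | rfl
    · exact h i hi
    · rw [h', cross_state h le_rfl]

/-- The word with given letters at positions below `n`. -/
def ofFin {n : ℕ} (x : Bool × (Fin n → Letter)) : Word :=
  ⟨x.1, fun i => if h : i < n then x.2 ⟨i, h⟩ else .V⟩

theorem ofFin_snoc_agreeOn {n : ℕ} (c : Bool) (f : Fin n → Letter) (ℓ : Letter) :
    (ofFin (n := n + 1) (c, Fin.snoc f ℓ)).AgreeOn (ofFin (c, f)) n := by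
  refine ⟨rfl, fun i hi => ?_⟩
  simp [ofFin, hi, hi.le, Fin.snoc]

theorem ofFin_snoc_letter {n : ℕ} (c : Bool) (f : Fin n → Letter) (ℓ : Letter) :
    (ofFin (n := n + 1) (c, Fin.snoc f ℓ)).letter n = ℓ := by
  simp [ofFin, Fin.snoc]

open Classical in
/-- The generating polynomial of the costs of the words ending in a given state. -/
noncomputable def genPoly (n : ℕ) (st : State) : ℤ[X] :=
  ∑ x : Bool × (Fin n → Letter),
    if (ofFin x).Valid n ∧ (ofFin x).state n = st then X ^ (ofFin x).cost n else 0

/-- The transfer matrix. -/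
noncomputable def transfer (st st' : State) : ℤ[X] :=
  ∑ ℓ : Letter, if ℓ.src = st.cross ∧ st.next ℓ = st' then X ^ st.cost ℓ else 0

theorem sum_snoc {M : Type*} [AddCommMonoid M] {n : ℕ} (g : (Fin (n + 1) → Letter) → M) :
    ∑ f, g f = ∑ f : Fin n → Letter, ∑ ℓ : Letter,
      g (Fin.snoc (α := fun _ : Fin (n + 1) => Letter) f ℓ) := by
  rw [← (Fin.snocEquiv fun _ : Fin (n + 1) => Letter).sum_comp g, Fintype.sum_prod_type, sum_comm]
  rfl

theorem genPoly_succ (n : ℕ) (st' : State) :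
    genPoly (n + 1) st' = ∑ st, transfer st st' * genPoly n st := by
  classical
  have h1 : genPoly (n + 1) st' = ∑ x : Bool × (Fin n → Letter), ∑ ℓ : Letter,
      if (ofFin x).Valid n ∧ (ℓ.src = ((ofFin x).state n).cross ∧
        ((ofFin x).state n).next ℓ = st') then
        X ^ (ofFin x).cost n * X ^ ((ofFin x).state n).cost ℓ else 0 := by
    unfold genPoly
    rw [Fintype.sum_prod_type, Fintype.sum_prod_type]
    refine sum_congr rfl fun c _ => ?_
    rw [sum_snoc]
    refine sum_congr rfl fun f _ => sum_congr rfl fun ℓ _ => ?_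
    have hag := ofFin_snoc_agreeOn c f ℓ
    have hl := ofFin_snoc_letter c f ℓ
    simp only [valid_succ_iff, state, cost, hl, hag.valid_iff, hag.state_cost.1, hag.state_cost.2,
      pow_add, and_assoc]
  rw [h1]
  simp only [genPoly, mul_sum]
  refine Eq.trans ?_ sum_comm
  refine sum_congr rfl fun x _ => ?_
  rw [sum_eq_single ((ofFin x).state n)]
  · rw [transfer, sum_mul]
    refine sum_congr rfl fun ℓ _ => ?_
    by_cases hv : (ofFin x).Valid n
    · simp only [hv, true_and, and_true, if_true]
      split_ifs <;> ring
    · simp [hv]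
  · intro st _ hst
    rw [if_neg fun h => hst h.2.symm, mul_zero]
  · simp

theorem genPoly_zero (st : State) :
    genPoly 0 st = (if st = .P then 1 else 0) + if st = .O then X else 0 := by
  classical
  unfold genPoly
  rw [Fintype.sum_prod_type, Fintype.sum_bool]
  have hv : ∀ w : Word, w.Valid 0 := fun w i hi => by omega
  simp only [hv, true_and, state, cost, ofFin, State.init]
  cases st <;> simp

theorem genPoly_succ_P (n : ℕ) : genPoly (n + 1) .P =
    2 * X ^ 3 * genPoly n .P + X ^ 2 * genPoly n .N + genPoly n .O := by
  rw [genPoly_succ]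
  simp [State.sum_eq, transfer, Letter.sum_eq, State.cross, State.next, Letter.src, State.cost]
  ring

theorem genPoly_succ_N (n : ℕ) : genPoly (n + 1) .N =
    3 * X ^ 2 * genPoly n .P + (X ^ 3 + 3 * X ^ 2) * genPoly n .N := by
  rw [genPoly_succ]
  simp [State.sum_eq, transfer, Letter.sum_eq, State.cross, State.next, Letter.src, State.cost]
  ring

theorem genPoly_succ_O (n : ℕ) : genPoly (n + 1) .O =
    X ^ 4 * genPoly n .P + X ^ 3 * genPoly n .N + X * genPoly n .O := by
  rw [genPoly_succ]
  simp [State.sum_eq, transfer, Letter.sum_eq, State.cross, State.next, Letter.src, State.cost]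
  ring

/-- By Cayley–Hamilton both sides satisfy the recurrence with coefficients `kerA`, `kerB`, `kerC`,
so three initial values decide. States `P` and `N` are those in which nothing crosses at the right
end. -/
theorem genPoly_eq (n : ℕ) :
    genPoly (n + 1) .P + genPoly (n + 1) .N = W (n + 1) - X ^ 3 * W n := by
  induction n using Nat.strong_induction_on with
  | _ n ih =>
    match n, ih with
    | 0, _ =>
      rw [show W (0 + 1) = kerA from W_one]
      simp only [genPoly_succ_P, genPoly_succ_N, genPoly_zero, W_zero, kerA]
      simp
      ring
    | 1, _ =>
      rw [show W (1 + 1) = kerA * W 1 + kerB from W_two]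
      simp only [genPoly_succ_P, genPoly_succ_N, genPoly_succ_O, genPoly_zero, W_one, kerA,
        kerB]
      simp
      ring
    | 2, _ =>
      rw [show W (2 + 1) = kerA * W 2 + (kerB * W 1 + kerC * W 0) from W_add_three 0]
      simp only [genPoly_succ_P, genPoly_succ_N, genPoly_succ_O, genPoly_zero, W_one,
        W_two, W_zero, kerA, kerB, kerC]
      simp
      ring
    | n + 3, ih =>
      have h0 := ih n (by omega)
      have h1 := ih (n + 1) (by omega)
      have h2 := ih (n + 2) (by omega)
      have e : W (n + 3 + 1) - X ^ 3 * W (n + 3) =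
          kerA * (W (n + 2 + 1) - X ^ 3 * W (n + 2)) +
          (kerB * (W (n + 1 + 1) - X ^ 3 * W (n + 1)) + kerC * (W (n + 1) - X ^ 3 * W n)) := by
        rw [W_add_three (n + 1), W_add_three n]
        ring
      rw [e, ← h0, ← h1, ← h2]
      rw [genPoly_succ_P (n + 3), genPoly_succ_N (n + 3), genPoly_succ_P (n + 2),
        genPoly_succ_N (n + 2), genPoly_succ_O (n + 2), genPoly_succ_P (n + 1),
        genPoly_succ_N (n + 1), genPoly_succ_O (n + 1), kerA, kerB, kerC]
      ring

end Word
end PolyominoAF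

/-! ### Perfect matchings as edge sets; the edges of the polyomino -/

namespace PolyominoAF

section General

variable {V : Type*} {G H : SimpleGraph V}

/-- A subgraph of `G` whose edges are edges of `H`, as a subgraph of `H`. -/
def transferSubgraph (M : G.Subgraph) (h : ∀ a b, M.Adj a b → H.Adj a b) : H.Subgraph where
  verts := M.verts
  Adj := M.Adj
  adj_sub {a b} hab := h a b hab
  edge_vert {_ _} hab := M.edge_vert hab
  symm := M.symm

theorem transferSubgraph_edgeSet (M : G.Subgraph) (h : ∀ a b, M.Adj a b → H.Adj a b) :
    (transferSubgraph M h).edgeSet = M.edgeSet := rfl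

theorem IsPerfectMatching.transfer {M : G.Subgraph} (hM : M.IsPerfectMatching)
    (h : ∀ a b, M.Adj a b → H.Adj a b) : (transferSubgraph M h).IsPerfectMatching := by
  rw [SimpleGraph.Subgraph.isPerfectMatching_iff] at *
  exact hM

theorem IsPerfectMatching.eq_of_edgeSet_eq {M M' : G.Subgraph} (hM : M.IsPerfectMatching)
    (hM' : M'.IsPerfectMatching) (h : M.edgeSet = M'.edgeSet) : M = M' :=
  SimpleGraph.Subgraph.IsMatching.injOn_edgeSet hM.1 hM'.1 h

/-- Perfect matchings of `G - S` are the perfect matchings of `G` disjoint from `S`, carried over by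
`transferSubgraph` and recognised by their edge sets. -/
theorem isAntiForcingSet_iff {M : G.Subgraph} (hM : M.IsPerfectMatching) {S : Set (Sym2 V)} :
    IsAntiForcingSet G M S ↔ S ⊆ G.edgeSet \ M.edgeSet ∧
      ∀ M' : G.Subgraph, M'.IsPerfectMatching → Disjoint M'.edgeSet S → M' = M := by
  refine and_congr_right fun hS => ⟨?_, fun h => ?_⟩
  · rintro ⟨N, hN, hu⟩ M' hM' hd
    have hsub : ∀ a b, M'.Adj a b → (G.deleteEdges S).Adj a b := fun a b hab =>
      SimpleGraph.deleteEdges_adj.2 ⟨M'.adj_sub hab, Set.disjoint_left.1 hd hab⟩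
    have := (hu _).1 (IsPerfectMatching.transfer hM' hsub)
    refine IsPerfectMatching.eq_of_edgeSet_eq hM' hM ?_
    rw [← hN, ← this]
    rfl
  · have hsub : ∀ a b, M.Adj a b → (G.deleteEdges S).Adj a b := fun a b hab =>
      SimpleGraph.deleteEdges_adj.2 ⟨M.adj_sub hab, fun hs => (hS hs).2 hab⟩
    refine ⟨transferSubgraph M hsub, rfl, fun N' => ⟨fun hN' => ?_, fun h' => ?_⟩⟩
    · have hsub' : ∀ a b, N'.Adj a b → G.Adj a b := fun a b hab =>
        (SimpleGraph.deleteEdges_adj.1 (N'.adj_sub hab)).1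
      have := h _ (IsPerfectMatching.transfer hN' hsub') (Set.disjoint_left.2 fun e => by
        induction e with
        | _ a b => exact fun hab => (SimpleGraph.deleteEdges_adj.1 (N'.adj_sub hab)).2)
      refine IsPerfectMatching.eq_of_edgeSet_eq hN' (IsPerfectMatching.transfer hM hsub) ?_
      rw [transferSubgraph_edgeSet, ← this]
      rfl
    · rw [h']
      exact IsPerfectMatching.transfer hM hsub

variable {E : Type*} {ends : E → Sym2 V}

/-- A set of edges, indexed by `E`, that covers every vertex exactly once. -/
def CoversOnce (ends : E → Sym2 V) (F : Set E) : Prop := ∀ v, ∃! e, e ∈ F ∧ v ∈ ends e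

theorem IsPerfectMatching.coversOnce {M : G.Subgraph} (hM : M.IsPerfectMatching)
    (hinj : Function.Injective ends) (hr : Set.range ends = G.edgeSet) :
    CoversOnce ends (ends ⁻¹' M.edgeSet) := by
  intro v
  obtain ⟨w, hw, hu⟩ := SimpleGraph.Subgraph.isPerfectMatching_iff.1 hM v
  have : s(v, w) ∈ Set.range ends := hr ▸ M.adj_sub hw
  obtain ⟨e, he⟩ := this
  refine ⟨e, ⟨by simpa [he] using hw, by simp [he]⟩, ?_⟩
  rintro e' ⟨h1, h2⟩
  obtain ⟨w', hw'⟩ := Sym2.mem_iff_exists.1 h2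
  rw [Set.mem_preimage, hw'] at h1
  have := hu w' h1
  exact hinj (by rw [hw', he, this])

/-- The spanning subgraph with a given set of edges. -/
def subgraphOf (ends : E → Sym2 V) (hr : Set.range ends = G.edgeSet) (F : Set E) :
    G.Subgraph where
  verts := Set.univ
  Adj a b := s(a, b) ∈ ends '' F
  adj_sub {a b} hab := by
    have := Set.image_subset_range _ _ hab
    rw [hr] at this
    exact this
  edge_vert _ := Set.mem_univ _
  symm := ⟨fun a b hab => by rwa [Sym2.eq_swap]⟩

theorem subgraphOf_edgeSet (hr : Set.range ends = G.edgeSet) (F : Set E) :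
    (subgraphOf ends hr F).edgeSet = ends '' F := by
  ext e
  induction e with
  | _ a b => rfl

theorem CoversOnce.isPerfectMatching {F : Set E} (hF : CoversOnce ends F)
    (hr : Set.range ends = G.edgeSet) : (subgraphOf ends hr F).IsPerfectMatching := by
  rw [SimpleGraph.Subgraph.isPerfectMatching_iff]
  intro v
  obtain ⟨e, ⟨he, hv⟩, hu⟩ := hF v
  obtain ⟨w, hw⟩ := Sym2.mem_iff_exists.1 hv
  refine ⟨w, ⟨e, he, hw⟩, ?_⟩
  rintro w' ⟨e', he', hw'⟩
  have := hu e' ⟨he', by rw [hw']; simp⟩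
  rw [this, hw] at hw'
  exact (Sym2.congr_right.1 hw').symm

end General

/-- Splitting off one candidate at a time turns unique covering of a vertex into propositional logic
on its incident edges. -/
theorem existsUnique_or {E : Type*} {p q : E → Prop} {a : E} (h : ¬ q a) :
    (∃! e, p e ∧ (e = a ∨ q e)) ↔ (p a ∧ ∀ e, q e → ¬ p e) ∨ (¬ p a ∧ ∃! e, p e ∧ q e) := by
  constructor
  · rintro ⟨e, ⟨hp, rfl | hq⟩, hu⟩
    · exact Or.inl ⟨hp, fun e' hq' hp' => h (hu e' ⟨hp', Or.inr hq'⟩ ▸ hq')⟩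
    · refine Or.inr ⟨fun hpa => h (hu a ⟨hpa, Or.inl rfl⟩ ▸ hq), e, ⟨hp, hq⟩, ?_⟩
      exact fun e' h' => hu e' ⟨h'.1, Or.inr h'.2⟩
  · rintro (⟨hp, hq⟩ | ⟨hp, e, ⟨hpe, hqe⟩, hu⟩)
    · refine ⟨a, ⟨hp, Or.inl rfl⟩, ?_⟩
      rintro e ⟨hpe, rfl | hqe⟩
      · rfl
      · exact absurd hpe (hq e hqe)
    · refine ⟨e, ⟨hpe, Or.inr hqe⟩, ?_⟩
      rintro e' ⟨hpe', rfl | hqe'⟩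
      · exact absurd hpe' hp
      · exact hu e' ⟨hpe', hqe'⟩

theorem existsUnique_and_eq {E : Type*} {p : E → Prop} {a : E} :
    (∃! e, p e ∧ e = a) ↔ p a :=
  ⟨fun ⟨_, h, _⟩ => h.2 ▸ h.1, fun h => ⟨a, ⟨h, rfl⟩, fun _ h' => h'.2⟩⟩

theorem existsUnique_and_exists_eq {E : Type*} {p : E → Prop} {P : Prop} {f : P → E} :
    (∃! e, p e ∧ ∃ h, e = f h) ↔ ∃ h, p (f h) :=
  ⟨fun ⟨_, h, _⟩ => h.2.elim fun h' he => ⟨h', he ▸ h.1⟩,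
    fun ⟨h, hp⟩ => ⟨f h, ⟨hp, h, rfl⟩, fun _ h' => h'.2.elim fun _ he => he⟩⟩

/-- The edges of the polyomino graph. -/
abbrev Edge (n : ℕ) := Option (Fin n × Kind)

section Edges

variable {n : ℕ}

def evenCol (k : Fin n) : Fin (2 * n + 1) := ⟨2 * k, by omega⟩
def oddCol (k : Fin n) : Fin (2 * n + 1) := ⟨2 * k + 1, by omega⟩
def nextCol (k : Fin n) : Fin (2 * n + 1) := ⟨2 * k + 2, by omega⟩
def fstIdx (k : Fin n) : Fin (2 * n) := ⟨2 * k, by omega⟩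
def sndIdx (k : Fin n) : Fin (2 * n) := ⟨2 * k + 1, by omega⟩

/-- The endpoints of an edge. -/
def ends : Edge n → Sym2 (Vertex n)
  | none => s(.u 0, .v 0)
  | some (k, .cu) => s(.u (evenCol k), .u (oddCol k))
  | some (k, .cv) => s(.v (evenCol k), .v (oddCol k))
  | some (k, .p) => s(.u (oddCol k), .v (oddCol k))
  | some (k, .q) => s(.u (nextCol k), .v (nextCol k))
  | some (k, .uu) => s(.u (oddCol k), .u (nextCol k))
  | some (k, .vv) => s(.v (oddCol k), .v (nextCol k))
  | some (k, .ww) => s(.w (fstIdx k), .w (sndIdx k))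
  | some (k, .zz) => s(.z (fstIdx k), .z (sndIdx k))
  | some (k, .wp) => s(.w (fstIdx k), .u (oddCol k))
  | some (k, .wq) => s(.w (sndIdx k), .u (nextCol k))
  | some (k, .zp) => s(.v (oddCol k), .z (fstIdx k))
  | some (k, .zq) => s(.v (nextCol k), .z (sndIdx k))

theorem ends_injective : Function.Injective (ends (n := n)) := by
  rintro (_ | ⟨k, κ⟩) (_ | ⟨k', κ'⟩) h
  · rfl
  · cases κ' <;> simp [ends, Fin.ext_iff, evenCol, oddCol, nextCol, fstIdx, sndIdx] at h
  · cases κ <;> simp [ends, Fin.ext_iff, evenCol, oddCol, nextCol, fstIdx, sndIdx] at h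
  · cases κ <;> cases κ' <;>
      simp [ends, Fin.ext_iff, evenCol, oddCol, nextCol, fstIdx, sndIdx] at h ⊢ <;> omega

theorem exists_ends_eq_of_edgeRel {a b : Vertex n} (h : edgeRel n a b) :
    ∃ e, ends e = s(a, b) := by
  have hk : ∀ i, i < 2 * n → i / 2 < n := fun i hi => by omega
  cases a with
  | u i =>
    cases b with
    | u j =>
      simp only [edgeRel] at h
      rcases Nat.even_or_odd' i.1 with ⟨k, hi | hi⟩
      · refine ⟨some (⟨k, by omega⟩, .cu), ?_⟩
        simp only [ends, evenCol, oddCol]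
        congr 3 <;> omega
      · refine ⟨some (⟨k, by omega⟩, .uu), ?_⟩
        simp only [ends, nextCol, oddCol]
        congr 3 <;> omega
    | v j =>
      simp only [edgeRel] at h
      subst h
      rcases Nat.eq_zero_or_pos i.1 with hi | hi
      · refine ⟨none, ?_⟩
        have : i = 0 := Fin.ext hi
        simp [ends, this]
      rcases Nat.even_or_odd' i.1 with ⟨k, hi' | hi'⟩
      · refine ⟨some (⟨k - 1, by omega⟩, .q), ?_⟩
        simp only [ends, nextCol]
        congr 3 <;> omega
      · refine ⟨some (⟨k, by omega⟩, .p), ?_⟩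
        simp only [ends, oddCol]
        congr 3 <;> omega
    | w => exact h.elim
    | z => exact h.elim
  | v i =>
    cases b with
    | u => exact h.elim
    | v j =>
      simp only [edgeRel] at h
      rcases Nat.even_or_odd' i.1 with ⟨k, hi | hi⟩
      · refine ⟨some (⟨k, by omega⟩, .cv), ?_⟩
        simp only [ends, evenCol, oddCol]
        congr 3 <;> omega
      · refine ⟨some (⟨k, by omega⟩, .vv), ?_⟩
        simp only [ends, nextCol, oddCol]
        congr 3 <;> omega
    | w => exact h.elim
    | z j =>
      simp only [edgeRel] at h
      rcases Nat.even_or_odd' j.1 with ⟨k, hi | hi⟩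
      · refine ⟨some (⟨k, by omega⟩, .zp), ?_⟩
        simp only [ends, fstIdx, oddCol]
        congr 3 <;> omega
      · refine ⟨some (⟨k, by omega⟩, .zq), ?_⟩
        simp only [ends, sndIdx, nextCol]
        congr 3 <;> omega
  | w i =>
    cases b with
    | u j =>
      simp only [edgeRel] at h
      rcases Nat.even_or_odd' i.1 with ⟨k, hi | hi⟩
      · refine ⟨some (⟨k, by omega⟩, .wp), ?_⟩
        simp only [ends, fstIdx, oddCol]
        congr 3 <;> omega
      · refine ⟨some (⟨k, by omega⟩, .wq), ?_⟩
        simp only [ends, sndIdx, nextCol]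
        congr 3 <;> omega
    | v => exact h.elim
    | w j =>
      obtain ⟨⟨k, hk⟩, h⟩ := h
      refine ⟨some (⟨k, by omega⟩, .ww), ?_⟩
      simp only [ends, fstIdx, sndIdx]
      congr 3 <;> omega
    | z => exact h.elim
  | z i =>
    cases b with
    | u => exact h.elim
    | v => exact h.elim
    | w => exact h.elim
    | z j =>
      obtain ⟨⟨k, hk⟩, h⟩ := h
      refine ⟨some (⟨k, by omega⟩, .zz), ?_⟩
      simp only [ends, fstIdx, sndIdx]
      congr 3 <;> omega

theorem range_ends : Set.range (ends (n := n)) = (polyomino n).edgeSet := by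
  apply Set.Subset.antisymm
  · rintro _ ⟨_ | ⟨k, κ⟩, rfl⟩
    · simp [ends, polyomino, edgeRel]
    · cases κ <;> simp [ends, polyomino, edgeRel, evenCol, oddCol, nextCol, fstIdx, sndIdx]
  · intro e
    induction e with
    | _ a b =>
      rintro ⟨-, h | h⟩
      · exact exists_ends_eq_of_edgeRel h
      · obtain ⟨e, he⟩ := exists_ends_eq_of_edgeRel h
        exact ⟨e, he.trans Sym2.eq_swap⟩

end Edges

end PolyominoAF

/-! ### Perfect matchings correspond to words -/

namespace PolyominoAF

section Covers

variable {n : ℕ} (F : Set (Edge n))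

/-- Whether the edge of kind `κ` of the `j`-th part belongs to `F`, if there is such a part. -/
def MemAt (κ : Kind) (j : ℕ) : Prop := ∃ h : j < n, some (⟨j, h⟩, κ) ∈ F

theorem mem_u_zero (e : Edge n) :
    Vertex.u 0 ∈ ends e ↔ e = none ∨ ∃ h : 0 < n, e = some (⟨0, h⟩, .cu) := by
  rcases e with _ | ⟨k, κ⟩
  · simp [ends]
  · cases κ <;> simp [ends, Fin.ext_iff, evenCol, oddCol, nextCol]
    omega

theorem mem_v_zero (e : Edge n) :
    Vertex.v 0 ∈ ends e ↔ e = none ∨ ∃ h : 0 < n, e = some (⟨0, h⟩, .cv) := by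
  rcases e with _ | ⟨k, κ⟩
  · simp [ends]
  · cases κ <;> simp [ends, Fin.ext_iff, evenCol, oddCol, nextCol]
    omega

theorem mem_u_oddCol (k : Fin n) (e : Edge n) : Vertex.u (oddCol k) ∈ ends e ↔
    e = some (k, .cu) ∨ e = some (k, .p) ∨ e = some (k, .uu) ∨ e = some (k, .wp) := by
  rcases e with _ | ⟨k', κ⟩
  · simp [ends, Fin.ext_iff, oddCol]
  · cases κ <;> simp [ends, Fin.ext_iff, evenCol, oddCol, nextCol] <;> omega

theorem mem_v_oddCol (k : Fin n) (e : Edge n) : Vertex.v (oddCol k) ∈ ends e ↔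
    e = some (k, .cv) ∨ e = some (k, .p) ∨ e = some (k, .vv) ∨ e = some (k, .zp) := by
  rcases e with _ | ⟨k', κ⟩
  · simp [ends, Fin.ext_iff, oddCol]
  · cases κ <;> simp [ends, Fin.ext_iff, evenCol, oddCol, nextCol] <;> omega

theorem mem_u_nextCol (k : Fin n) (e : Edge n) : Vertex.u (nextCol k) ∈ ends e ↔
    e = some (k, .uu) ∨ e = some (k, .q) ∨ e = some (k, .wq) ∨
      ∃ h : k + 1 < n, e = some (⟨k + 1, h⟩, .cu) := by
  rcases e with _ | ⟨k', κ⟩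
  · simp [ends, Fin.ext_iff, nextCol]
  · cases κ <;> simp [ends, Fin.ext_iff, evenCol, oddCol, nextCol] <;> omega

theorem mem_v_nextCol (k : Fin n) (e : Edge n) : Vertex.v (nextCol k) ∈ ends e ↔
    e = some (k, .vv) ∨ e = some (k, .q) ∨ e = some (k, .zq) ∨
      ∃ h : k + 1 < n, e = some (⟨k + 1, h⟩, .cv) := by
  rcases e with _ | ⟨k', κ⟩
  · simp [ends, Fin.ext_iff, nextCol]
  · cases κ <;> simp [ends, Fin.ext_iff, evenCol, oddCol, nextCol] <;> omega

theorem mem_w_fstIdx (k : Fin n) (e : Edge n) : Vertex.w (fstIdx k) ∈ ends e ↔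
    e = some (k, .ww) ∨ e = some (k, .wp) := by
  rcases e with _ | ⟨k', κ⟩
  · simp [ends]
  · cases κ <;> simp [ends, Fin.ext_iff, fstIdx, sndIdx] <;> omega

theorem mem_w_sndIdx (k : Fin n) (e : Edge n) : Vertex.w (sndIdx k) ∈ ends e ↔
    e = some (k, .ww) ∨ e = some (k, .wq) := by
  rcases e with _ | ⟨k', κ⟩
  · simp [ends]
  · cases κ <;> simp [ends, Fin.ext_iff, fstIdx, sndIdx] <;> omega

theorem mem_z_fstIdx (k : Fin n) (e : Edge n) : Vertex.z (fstIdx k) ∈ ends e ↔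
    e = some (k, .zz) ∨ e = some (k, .zp) := by
  rcases e with _ | ⟨k', κ⟩
  · simp [ends]
  · cases κ <;> simp [ends, Fin.ext_iff, fstIdx, sndIdx] <;> omega

theorem mem_z_sndIdx (k : Fin n) (e : Edge n) : Vertex.z (sndIdx k) ∈ ends e ↔
    e = some (k, .zz) ∨ e = some (k, .zq) := by
  rcases e with _ | ⟨k', κ⟩
  · simp [ends]
  · cases κ <;> simp [ends, Fin.ext_iff, fstIdx, sndIdx] <;> omega

/-- Exactly one of four propositions holds. -/
def OneOf (a b c d : Prop) : Prop :=
  (a ∧ ¬ b ∧ ¬ c ∧ ¬ d) ∨ (¬ a ∧ b ∧ ¬ c ∧ ¬ d) ∨ (¬ a ∧ ¬ b ∧ c ∧ ¬ d) ∨ (¬ a ∧ ¬ b ∧ ¬ c ∧ d)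

theorem forall_vertex {P : Vertex n → Prop} : (∀ v, P v) ↔ (P (.u 0) ∧ P (.v 0)) ∧ ∀ k : Fin n,
    P (.u (oddCol k)) ∧ P (.v (oddCol k)) ∧ P (.u (nextCol k)) ∧ P (.v (nextCol k)) ∧
    P (.w (fstIdx k)) ∧ P (.w (sndIdx k)) ∧ P (.z (fstIdx k)) ∧ P (.z (sndIdx k)) := by
  refine ⟨fun h => ⟨⟨h _, h _⟩, fun k => ⟨h _, h _, h _, h _, h _, h _, h _, h _⟩⟩, ?_⟩
  rintro ⟨⟨h1, h2⟩, h⟩ v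
  have hcol : ∀ i : Fin (2 * n + 1), i = 0 ∨ ∃ k, i = oddCol k ∨ i = nextCol k := by
    intro i
    rcases Nat.eq_zero_or_pos i.1 with hi | hi
    · exact Or.inl (Fin.ext hi)
    · refine Or.inr ⟨⟨(i - 1) / 2, by omega⟩, ?_⟩
      simp only [Fin.ext_iff, oddCol, nextCol]
      omega
  have hidx : ∀ i : Fin (2 * n), ∃ k, i = fstIdx k ∨ i = sndIdx k := by
    intro i
    refine ⟨⟨i / 2, by omega⟩, ?_⟩
    simp only [Fin.ext_iff, fstIdx, sndIdx]
    omega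
  cases v with
  | u i =>
    rcases hcol i with rfl | ⟨k, rfl | rfl⟩
    · exact h1
    · exact (h k).1
    · exact (h k).2.2.1
  | v i =>
    rcases hcol i with rfl | ⟨k, rfl | rfl⟩
    · exact h2
    · exact (h k).2.1
    · exact (h k).2.2.2.1
  | w i =>
    rcases hidx i with ⟨k, rfl | rfl⟩
    · exact (h k).2.2.2.2.1
    · exact (h k).2.2.2.2.2.1
  | z i =>
    rcases hidx i with ⟨k, rfl | rfl⟩
    · exact (h k).2.2.2.2.2.2.1
    · exact (h k).2.2.2.2.2.2.2

theorem existsUnique_mem_iff_four {e₁ e₂ e₃ e₄ : Edge n} (h1 : e₁ ≠ e₂) (h2 : e₁ ≠ e₃)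
    (h3 : e₁ ≠ e₄) (h4 : e₂ ≠ e₃) (h5 : e₂ ≠ e₄) (h6 : e₃ ≠ e₄) :
    (∃! e, e ∈ F ∧ (e = e₁ ∨ e = e₂ ∨ e = e₃ ∨ e = e₄)) ↔
      OneOf (e₁ ∈ F) (e₂ ∈ F) (e₃ ∈ F) (e₄ ∈ F) := by
  rw [existsUnique_or (by simp [h1, h2, h3]), existsUnique_or (by simp [h4, h5]),
    existsUnique_or (by exact h6), existsUnique_and_eq]
  simp only [forall_eq_or_imp, forall_eq, OneOf]
  tauto

theorem existsUnique_mem_iff_next {e₁ e₂ e₃ : Edge n} {κ : Kind} {k : Fin n} (h1 : e₁ ≠ e₂)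
    (h2 : e₁ ≠ e₃) (h4 : e₂ ≠ e₃) (h3 : ∀ h : k + 1 < n, e₁ ≠ some (⟨k + 1, h⟩, κ))
    (h5 : ∀ h : k + 1 < n, e₂ ≠ some (⟨k + 1, h⟩, κ))
    (h6 : ∀ h : k + 1 < n, e₃ ≠ some (⟨k + 1, h⟩, κ)) :
    (∃! e, e ∈ F ∧ (e = e₁ ∨ e = e₂ ∨ e = e₃ ∨ ∃ h : k + 1 < n, e = some (⟨k + 1, h⟩, κ))) ↔
      OneOf (e₁ ∈ F) (e₂ ∈ F) (e₃ ∈ F) (MemAt F κ (k + 1)) := by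
  rw [existsUnique_or, existsUnique_or, existsUnique_or, existsUnique_and_exists_eq]
  · simp only [forall_eq_or_imp, forall_exists_index, OneOf, MemAt, not_exists,
      forall_comm (α := Edge n), forall_eq]
    tauto
  · simpa using h6
  · simpa [h4] using h5
  · simpa [h1, h2] using h3

theorem existsUnique_mem_iff_two {e₁ e₂ : Edge n} (h1 : e₁ ≠ e₂) :
    (∃! e, e ∈ F ∧ (e = e₁ ∨ e = e₂)) ↔ (e₁ ∈ F ↔ e₂ ∉ F) := by
  rw [existsUnique_or (by exact h1), existsUnique_and_eq]
  simp only [forall_eq]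
  tauto

theorem existsUnique_mem_iff_base {κ : Kind} :
    (∃! e : Edge n, e ∈ F ∧ (e = none ∨ ∃ h : 0 < n, e = some (⟨0, h⟩, κ))) ↔
      (none ∈ F ↔ ¬ MemAt F κ 0) := by
  rw [existsUnique_or (by simp), existsUnique_and_exists_eq]
  have h : (∀ e : Edge n, (∃ h : 0 < n, e = some (⟨0, h⟩, κ)) → e ∉ F) ↔ ¬ MemAt F κ 0 :=
    ⟨fun h ⟨h0, h1⟩ => h _ ⟨h0, rfl⟩ h1, fun h e ⟨h0, he⟩ he' => h ⟨h0, he ▸ he'⟩⟩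
  rw [h, MemAt]
  tauto

/-- The conditions on the edges of a part, and of the edges leaving it to the right, that say that
its vertices are covered once. -/
def LocalCond (f : Kind → Prop) (nu nv : Prop) : Prop :=
  OneOf (f .cu) (f .p) (f .uu) (f .wp) ∧ OneOf (f .cv) (f .p) (f .vv) (f .zp) ∧
  OneOf (f .uu) (f .q) (f .wq) nu ∧ OneOf (f .vv) (f .q) (f .zq) nv ∧
  (f .ww ↔ ¬ f .wp) ∧ (f .ww ↔ ¬ f .wq) ∧ (f .zz ↔ ¬ f .zp) ∧ (f .zz ↔ ¬ f .zq)

theorem coversOnce_iff : CoversOnce ends F ↔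
    ((none ∈ F ↔ ¬ MemAt F .cu 0) ∧ (none ∈ F ↔ ¬ MemAt F .cv 0)) ∧
    ∀ k : Fin n, LocalCond (fun κ => some (k, κ) ∈ F) (MemAt F .cu (k + 1))
      (MemAt F .cv (k + 1)) := by
  unfold CoversOnce
  rw [forall_vertex]
  simp only [mem_u_zero, mem_v_zero, mem_u_oddCol, mem_v_oddCol, mem_u_nextCol, mem_v_nextCol,
    mem_w_fstIdx, mem_w_sndIdx, mem_z_fstIdx, mem_z_sndIdx, existsUnique_mem_iff_base, LocalCond]
  refine and_congr_right fun _ => forall_congr' fun k => ?_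
  rw [existsUnique_mem_iff_four, existsUnique_mem_iff_four, existsUnique_mem_iff_next,
    existsUnique_mem_iff_next, existsUnique_mem_iff_two, existsUnique_mem_iff_two,
    existsUnique_mem_iff_two, existsUnique_mem_iff_two]
  all_goals simp

/-- Covering the `w`'s forces `wp ↔ wq`, so the conditions at the two `u`'s give `cu + p = q + nu`
as 0-1 counts. Likewise `cv + p = q + nv`, so equal usage on the left gives equal usage on the
right. The letter is then found by cases on `wp`, `zp`, `cu`, `p`, `q`. -/
theorem exists_letter {f : Kind → Prop} {nu nv : Prop} (h : LocalCond f nu nv)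
    (hc : f .cu ↔ f .cv) : (nu ↔ nv) ∧ ∃ ℓ : Letter, (∀ κ, f κ ↔ ℓ.has κ = true) ∧
      (nu ↔ ℓ.tgt = true) := by
  have hall : ∀ ℓ : Letter, (∀ κ, f κ ↔ ℓ.has κ = true) ↔
      (f .cu ↔ ℓ.has .cu = true) ∧ (f .cv ↔ ℓ.has .cv = true) ∧
      (f .p ↔ ℓ.has .p = true) ∧ (f .q ↔ ℓ.has .q = true) ∧ (f .uu ↔ ℓ.has .uu = true) ∧
      (f .vv ↔ ℓ.has .vv = true) ∧ (f .ww ↔ ℓ.has .ww = true) ∧ (f .zz ↔ ℓ.has .zz = true) ∧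
      (f .wp ↔ ℓ.has .wp = true) ∧ (f .wq ↔ ℓ.has .wq = true) ∧ (f .zp ↔ ℓ.has .zp = true) ∧
      (f .zq ↔ ℓ.has .zq = true) := by
    refine fun ℓ => ⟨fun h => ⟨h _, h _, h _, h _, h _, h _, h _, h _, h _, h _, h _, h _⟩, ?_⟩
    rintro ⟨h1, h2, h3, h4, h5, h6, h7, h8, h9, h10, h11, h12⟩ κ
    cases κ <;> assumption
  simp only [hall]
  clear hall
  obtain ⟨h1, h2, h3, h4, h5, h6, h7, h8⟩ := h
  unfold OneOf at h1 h2 h3 h4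
  generalize f .cu = cu at *
  generalize f .cv = cv at *
  generalize f .p = p at *
  generalize f .q = q at *
  generalize f .uu = uu at *
  generalize f .vv = vv at *
  generalize f .ww = ww at *
  generalize f .zz = zz at *
  generalize f .wp = wp at *
  generalize f .wq = wq at *
  generalize f .zp = zp at *
  generalize f .zq = zq at *
  have key : (nu ↔ nv) ∧ ((wp ∧ zp) ∨ (wp ∧ ¬ zp) ∨ (¬ wp ∧ zp) ∨ (¬ wp ∧ ¬ zp ∧ cu ∧ q) ∨
      (¬ wp ∧ ¬ zp ∧ cu ∧ ¬ q) ∨ (¬ wp ∧ ¬ zp ∧ ¬ cu ∧ p ∧ q) ∨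
      (¬ wp ∧ ¬ zp ∧ ¬ cu ∧ p ∧ ¬ q) ∨ (¬ wp ∧ ¬ zp ∧ ¬ cu ∧ ¬ p)) := by
    grind
  obtain ⟨hn, hk⟩ := key
  refine ⟨hn, ?_⟩
  rcases hk with hk | hk | hk | hk | hk | hk | hk | hk
  · exact ⟨.X, by simp [Letter.has, Letter.tgt]; grind⟩
  · exact ⟨.D, by simp [Letter.has, Letter.tgt]; grind⟩
  · exact ⟨.U, by simp [Letter.has, Letter.tgt]; grind⟩
  · exact ⟨.d, by simp [Letter.has, Letter.tgt]; grind⟩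
  · exact ⟨.b, by simp [Letter.has, Letter.tgt]; grind⟩
  · exact ⟨.V, by simp [Letter.has, Letter.tgt]; grind⟩
  · exact ⟨.a, by simp [Letter.has, Letter.tgt]; grind⟩
  · exact ⟨.H, by simp [Letter.has, Letter.tgt]; grind⟩

theorem localCond_letter (ℓ : Letter) {nu nv : Prop} (hu : nu ↔ ℓ.tgt = true)
    (hv : nv ↔ ℓ.tgt = true) : LocalCond (fun κ => ℓ.has κ = true) nu nv := by
  cases ℓ <;> simp_all [LocalCond, OneOf, Letter.has, Letter.tgt]

end Covers

namespace Word

variable {n : ℕ}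

/-- The edges of the matching coded by a word. -/
def edges (w : Word) (n : ℕ) : Set (Edge n)
  | none => w.start = false
  | some (k, κ) => (w.letter k).has κ = true

theorem none_mem_edges {w : Word} : (none : Edge n) ∈ w.edges n ↔ w.start = false := Iff.rfl

theorem some_mem_edges {w : Word} {k : Fin n} {κ : Kind} :
    some (k, κ) ∈ w.edges n ↔ (w.letter k).has κ = true := Iff.rfl

theorem has_cu (ℓ : Letter) : ℓ.has .cu = ℓ.src := by cases ℓ <;> rfl
theorem has_cv (ℓ : Letter) : ℓ.has .cv = ℓ.src := by cases ℓ <;> rfl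

theorem memAt_edges_iff {w : Word} {κ : Kind} {j : ℕ} (hκ : ∀ ℓ : Letter, ℓ.has κ = ℓ.src)
    (hw : w.Valid n) (hn : w.cross n = false) (hj : j ≤ n) :
    MemAt (w.edges n) κ j ↔ w.cross j = true := by
  constructor
  · rintro ⟨h, h'⟩
    rw [some_mem_edges, hκ] at h'
    rw [← hw j h, ← h']
  · intro h
    -- At `j = n` there is no part, which matches the word not crossing there.
    have hlt : j < n := lt_of_le_of_ne hj fun e => by simp [e, hn] at h
    exact ⟨hlt, by rw [some_mem_edges, hκ, ← h]; exact hw j hlt⟩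

theorem coversOnce_edges {w : Word} (hw : w.Valid n) (hn : w.cross n = false) :
    CoversOnce ends (w.edges n) := by
  rw [coversOnce_iff]
  refine ⟨⟨?_, ?_⟩, fun k => ?_⟩
  · rw [memAt_edges_iff has_cu hw hn (Nat.zero_le _), none_mem_edges]
    simp [cross]
  · rw [memAt_edges_iff has_cv hw hn (Nat.zero_le _), none_mem_edges]
    simp [cross]
  · exact localCond_letter (w.letter k) (memAt_edges_iff has_cu hw hn (by omega))
      (memAt_edges_iff has_cv hw hn (by omega))

theorem agreeOn_of_edges_eq {w w' : Word} (h : w.edges n = w'.edges n) : w.AgreeOn w' n := by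
  constructor
  · have := Set.ext_iff.1 h none
    simp only [none_mem_edges] at this
    revert this
    cases w.start <;> cases w'.start <;> simp
  · intro i hi
    refine Letter.eq_of_has_eq fun κ => ?_
    have := Set.ext_iff.1 h (some (⟨i, hi⟩, κ))
    simp only [some_mem_edges] at this
    rwa [← Bool.eq_iff_iff] at this

theorem AgreeOn.edges_eq {w w' : Word} (h : w.AgreeOn w' n) : w.edges n = w'.edges n := by
  ext (_ | ⟨k, κ⟩)
  · simp only [none_mem_edges, h.1]
  · simp only [some_mem_edges, h.2 k k.2]

theorem exists_edges_eq {F : Set (Edge n)} (hF : CoversOnce ends F) :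
    ∃ w : Word, w.Valid n ∧ w.cross n = false ∧ w.edges n = F := by
  classical
  rw [coversOnce_iff] at hF
  obtain ⟨⟨h1, h2⟩, h⟩ := hF
  -- Both edges from column `0` are used exactly when `none ∉ F`; equality then propagates to the
  -- right.
  have hcross : ∀ j ≤ n, (MemAt F .cu j ↔ MemAt F .cv j) := by
    intro j
    induction j with
    | zero => intro _; tauto
    | succ j ih =>
      intro hj
      have hc := ih (by omega)
      refine (exists_letter (h ⟨j, hj⟩) ?_).1
      exact ⟨fun h => (hc.1 ⟨hj, h⟩).2, fun h => (hc.2 ⟨hj, h⟩).2⟩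
  have hl : ∀ k : Fin n, ∃ ℓ : Letter, (∀ κ, some (k, κ) ∈ F ↔ ℓ.has κ = true) ∧
      (MemAt F .cu (k + 1) ↔ ℓ.tgt = true) := by
    intro k
    have hc := hcross k k.2.le
    exact (exists_letter (h k) ⟨fun h => (hc.1 ⟨k.2, h⟩).2, fun h => (hc.2 ⟨k.2, h⟩).2⟩).2
  choose L hL1 hL2 using hl
  let w : Word := ⟨!decide (none ∈ F), fun i => if h : i < n then L ⟨i, h⟩ else .V⟩
  have hletter : ∀ k : Fin n, w.letter k = L k := fun k => by simp [w]
  have hw : ∀ j ≤ n, (w.cross j = true ↔ MemAt F .cu j) := by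
    intro j hj
    cases j with
    | zero => simp [cross, w, h1]
    | succ j =>
      have := hletter ⟨j, hj⟩
      simp only [cross] at this ⊢
      rw [this, ← hL2 ⟨j, hj⟩]
  refine ⟨w, fun i hi => ?_, ?_, ?_⟩
  · rw [Bool.eq_iff_iff, hw i hi.le, ← has_cu, hletter ⟨i, hi⟩, ← hL1]
    exact ⟨fun h => ⟨hi, h⟩, fun h => h.2⟩
  · rw [Bool.eq_false_iff, Ne, hw n le_rfl]
    rintro ⟨h, -⟩
    exact lt_irrefl _ h
  · ext (_ | ⟨k, κ⟩)
    · rw [none_mem_edges]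
      simp [w]
    · rw [some_mem_edges, hletter, ← hL1]

end Word

end PolyominoAF

/-! ### The anti-forcing number is the cost; conclusion -/

namespace PolyominoAF

open Finset

section

variable {n : ℕ} {M : (polyomino n).Subgraph} {w : Word}

theorem exists_word (hM : M.IsPerfectMatching) :
    ∃ w : Word, w.Valid n ∧ w.cross n = false ∧ w.edges n = ends ⁻¹' M.edgeSet :=
  Word.exists_edges_eq (IsPerfectMatching.coversOnce hM ends_injective range_ends)

theorem eq_of_preimage_eq {M' : (polyomino n).Subgraph} (hM : M.IsPerfectMatching)
    (hM' : M'.IsPerfectMatching) (h : ends ⁻¹' M.edgeSet = ends (n := n) ⁻¹' M'.edgeSet) :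
    M = M' := by
  refine IsPerfectMatching.eq_of_edgeSet_eq hM hM' ?_
  have hs : ∀ N : (polyomino n).Subgraph, N.edgeSet ⊆ Set.range ends := fun N => by
    rw [range_ends]
    exact N.edgeSet_subset
  rw [← Set.image_preimage_eq_of_subset (hs M), h, Set.image_preimage_eq_of_subset (hs M')]

theorem sum_edge {R : Type*} [AddCommMonoid R] (f : Edge n → R) :
    ∑ e, f e = f none + ∑ k : Fin n, ∑ κ, f (some (k, κ)) := by
  rw [Fintype.sum_option, Fintype.sum_prod_type]

theorem Word.cost_eq_sum {w : Word} (hw : w.Valid n) : w.cost n =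
    w.start.toNat + ∑ k : Fin n, ∑ κ, ((w.state k).cut (w.letter k) κ).toNat := by
  rw [Fin.sum_univ_eq_sum_range fun k => ∑ κ, ((w.state k).cut (w.letter k) κ).toNat]
  induction n with
  | zero => simp [Word.cost]
  | succ n ih =>
    have hw' := hw.mono (Nat.le_succ n)
    rw [Word.cost, ih hw', sum_range_succ, (Word.cut_step (w.state n) (w.letter n)
      (by rw [Word.cross_state hw' le_rfl, hw n (by omega)])).2.1, add_assoc]

/-- Whether an edge belongs to the chosen anti-forcing set. -/
def Word.cutEdge (w : Word) : Edge n → Bool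
  | none => w.start
  | some (k, κ) => (w.state k).cut (w.letter k) κ

theorem exists_antiForcingSet (hM : M.IsPerfectMatching) (hw : w.Valid n)
    (hM' : w.edges n = ends ⁻¹' M.edgeSet) : ∃ S : Finset (Sym2 (Vertex n)),
      IsAntiForcingSet (polyomino n) M S ∧ S.card ≤ w.cost n := by
  classical
  refine ⟨(univ.filter fun e : Edge n => w.cutEdge e = true).image ends, ?_, ?_⟩
  · rw [isAntiForcingSet_iff hM]
    constructor
    · intro e he
      simp only [coe_image, coe_filter, mem_univ, true_and, Set.mem_image, Set.mem_ofPred_eq] at he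
      obtain ⟨e, he, rfl⟩ := he
      refine ⟨range_ends ▸ Set.mem_range_self e, fun h => ?_⟩
      have h' : e ∈ w.edges n := by rw [hM']; exact h
      rcases e with _ | ⟨k, κ⟩
      · rw [Word.none_mem_edges] at h'
        simp [Word.cutEdge, h'] at he
      · have := (Word.cut_step (w.state k) (w.letter k)
          (by rw [Word.cross_state hw k.2.le, hw k k.2])).1 κ he
        rw [Word.some_mem_edges, this] at h'
        simp at h'
    · intro N hN hd
      obtain ⟨w', hv, hc, hE⟩ := exists_word hN
      have hnot : ∀ e : Edge n, e ∈ w'.edges n → w.cutEdge e ≠ true := by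
        intro e he he'
        rw [hE] at he
        refine Set.disjoint_left.1 hd he ?_
        simp only [coe_image, coe_filter, mem_univ, true_and]
        exact Set.mem_image_of_mem _ he'
      have := Word.eq_of_avoids_cut hw hv hc ⟨fun h => hnot none h,
        fun i hi κ h => hnot (some (⟨i, hi⟩, κ)) h⟩
      exact eq_of_preimage_eq hN hM (by rw [← hE, ← hM', this.edges_eq])
  · refine card_image_le.trans ?_
    rw [card_filter, sum_edge, Word.cost_eq_sum hw]
    refine le_of_eq ?_
    simp only [Word.cutEdge]
    congr 1
    · by_cases h : w.start = true <;> simp [h]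
    · refine sum_congr rfl fun k _ => sum_congr rfl fun κ _ => ?_
      by_cases h : (w.state k).cut (w.letter k) κ = true <;> simp [h]

/-- The set `S` has at least as many elements as there are indices `e` with `ends e ∈ S`, because
`ends` is injective, and these indices meet every word other than `w`. -/
theorem cost_le_card (hM : M.IsPerfectMatching) (hw : w.Valid n) (hn : w.cross n = false)
    (hM' : w.edges n = ends ⁻¹' M.edgeSet) {S : Finset (Sym2 (Vertex n))}
    (hS : IsAntiForcingSet (polyomino n) M S) : w.cost n ≤ S.card := by
  classical
  rw [isAntiForcingSet_iff hM] at hS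
  obtain ⟨hS1, hS2⟩ := hS
  have hnot : ∀ e : Edge n, e ∈ w.edges n → ends e ∉ S := fun e he hs => by
    rw [hM'] at he
    exact (hS1 hs).2 he
  have hle := Word.cost_le_of_meets (w := w) (n := n) (s₀ := ends (none : Edge n) ∈ S)
    (s := fun i κ => ∃ h : i < n, ends (some (⟨i, h⟩, κ) : Edge n) ∈ S) hw
    ⟨fun h => hnot none h, fun i hi κ h ⟨_, h'⟩ => hnot (some (⟨i, hi⟩, κ)) h h'⟩ hn ?_
  · refine hle.trans ?_
    have : (univ.filter fun e : Edge n => ends e ∈ S).card ≤ S.card :=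
      card_le_card_of_injOn ends (fun e he => by simpa using he) ends_injective.injOn
    refine le_trans (le_of_eq ?_) this
    rw [card_filter, sum_edge, sum_range]
    simp
  · intro w' hv hc ha
    have hN := (Word.coversOnce_edges hv hc).isPerfectMatching range_ends
    have heq := hS2 _ hN (by
      rw [subgraphOf_edgeSet, Set.disjoint_left]
      rintro _ ⟨_ | ⟨k, κ⟩, he, rfl⟩ hs
      · exact ha.1 he hs
      · exact ha.2 k k.2 κ he ⟨k.2, hs⟩)
    refine Word.agreeOn_of_edges_eq (n := n) ?_
    rw [hM', ← heq, subgraphOf_edgeSet, Set.preimage_image_eq _ ends_injective]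

theorem antiForcingNumber_eq_cost (hM : M.IsPerfectMatching) (hw : w.Valid n)
    (hn : w.cross n = false) (hM' : w.edges n = ends ⁻¹' M.edgeSet) :
    antiForcingNumber (polyomino n) M = w.cost n := by
  obtain ⟨S, hS, hc⟩ := exists_antiForcingSet hM hw hM'
  unfold antiForcingNumber
  refine le_antisymm (le_trans (Nat.sInf_le ⟨S, hS, rfl⟩) hc) ?_
  apply le_csInf
  · exact ⟨_, S, hS, rfl⟩
  · rintro _ ⟨T, hT, rfl⟩
    exact cost_le_card hM hw hn hM' hT

end

theorem Word.ofFin_agreeOn (w : Word) (n : ℕ) :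
    (Word.ofFin (n := n) (w.start, fun i => w.letter i)).AgreeOn w n :=
  ⟨rfl, fun i hi => by simp [Word.ofFin, hi]⟩

theorem Word.eq_of_ofFin_agreeOn {n : ℕ} {x y : Bool × (Fin n → Letter)}
    (h : (Word.ofFin x).AgreeOn (Word.ofFin y) n) : x = y := by
  refine Prod.ext h.1 (funext fun i => ?_)
  simpa [Word.ofFin] using h.2 i i.2

/-- Valid words that do not cross at `n` are those ending in state `P` or `N`, and they are in
bijection with the perfect matchings. -/
theorem antiForcingPolynomial_eq (n : ℕ) : antiForcingPolynomial (polyomino n) =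
    Word.genPoly n .P + Word.genPoly n .N := by
  classical
  have h1 : Word.genPoly n .P + Word.genPoly n .N = ∑ x : Bool × (Fin n → Letter),
      if (Word.ofFin x).Valid n ∧ (Word.ofFin x).cross n = false then
        (Polynomial.X : Polynomial ℤ) ^ (Word.ofFin x).cost n else 0 := by
    unfold Word.genPoly
    rw [← sum_add_distrib]
    refine sum_congr rfl fun x _ => ?_
    by_cases hv : (Word.ofFin x).Valid n
    · rw [← Word.cross_state hv le_rfl]
      cases (Word.ofFin x).state n <;> simp [hv, State.cross]
    · simp [hv]
  rw [h1, ← sum_filter]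
  unfold antiForcingPolynomial
  have hw := fun M : {M : (polyomino n).Subgraph // M.IsPerfectMatching} => exists_word M.2
  choose w hv hc hE using hw
  have hag := fun M => Word.ofFin_agreeOn (w M) n
  refine sum_bij (fun M _ => ((w M).start, fun i => (w M).letter i)) ?_ ?_ ?_ ?_
  · intro M _
    rw [mem_filter]
    exact ⟨mem_univ _, (hag M).symm.valid (hv M), by rw [(hag M).cross le_rfl, hc]⟩
  · intro M _ M' _ h
    refine Subtype.ext (eq_of_preimage_eq M.2 M'.2 ?_)
    rw [← hE, ← hE, ← (hag M).edges_eq, ← (hag M').edges_eq]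
    exact congrArg (fun x => (Word.ofFin x).edges n) h
  · intro x hx
    rw [mem_filter] at hx
    obtain ⟨-, hx1, hx2⟩ := hx
    let M : {M : (polyomino n).Subgraph // M.IsPerfectMatching} :=
      ⟨_, (Word.coversOnce_edges hx1 hx2).isPerfectMatching range_ends⟩
    refine ⟨M, @mem_univ _ (_) M, Word.eq_of_ofFin_agreeOn (Word.agreeOn_of_edges_eq ?_)⟩
    rw [(hag M).edges_eq, hE, subgraphOf_edgeSet, Set.preimage_image_eq _ ends_injective]
  · intro M _
    rw [antiForcingNumber_eq_cost M.2 (hv M) (hc M) (hE M), (hag M).state_cost.2]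

end PolyominoAF

theorem theorem4p2 (n : ℕ) (hn : 1 ≤ n) :
    PolyominoAF.antiForcingPolynomial (PolyominoAF.polyomino n) =
      PolyominoAF.R n + PolyominoAF.Q n + 3 * Polynomial.X ^ (n + 1) + Polynomial.X ^ n := by
  obtain ⟨m, rfl⟩ := Nat.exists_eq_add_of_le' hn
  rw [PolyominoAF.antiForcingPolynomial_eq, PolyominoAF.Word.genPoly_eq, PolyominoAF.R_add_Q_eq]
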